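/- Let $(\Lambda,\mathcal E)$ be a finite simple graph, $S\in\mathbb N$ an integer spin, $\beta>0$, $u\in[0,1]$ and $\boldsymbol h=(h_x)_{x\in\Lambda}\in\mathbb R^\Lambda$. On $\mathcal H_\Lambda=\bigotimes_{x\in\Lambda}\mathbb C^{2S+1}$, with orthonormal basis $|\sigma\rangle$, $\sigma\in\{-S,\dots,S\}^\Lambda$, let $S_x^3|\sigma\rangle=\sigma_x|\sigma\rangle$, and for an edge $\{x,y\}$ let $T_{xy}$, $P_{xy}$ be the operators acting on the sites $x,y$ by $$T_{xy}|a,b\rangle=|b,a\rangle,\qquad \langle a,b|P_{xy}|c,d\rangle=(-1)^{a-c}\,\delta_{a,-b}\,\delta_{c,-d}.$$ Let $$\tilde H=-\sum_{\{x,y\}\in\mathcal E}\bigl(uT_{xy}+(1-u)P_{xy}-1\bigr)-\sum_{x\in\Lambda}h_xS_x^3,\qquad \tilde Z^{(u)}(\beta,\Lambda,\boldsymbol h)=\operatorname{Tr}\,e^{-\beta\tilde H}.$$ Let $\rho(\mathrm d\omega)$ be the law of independent Poisson point processes on the intervals $[0,\beta]$ attached to the edges, where "crosses" occur with intensity $u$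 and "double bars" with intensity $1-u$. For almost every realization $\omega$, the vertical lines $\Lambda\times[0,\beta]$ (with the times $0$ and $\beta$ identified) are decomposed into the finite set $\mathcal L(\omega)$ of loops: a trajectory follows a vertical line until it meets a transition; at a cross at $\{x,y\}$ and time $t$ it moves to the other site of the edge and keeps its vertical direction (joining $(x,t-)$ with $(y,t+)$ and $(y,t-)$ with $(x,t+)$); at a double bar it moves to the other site and reverses its vertical direction (joining $(x,t-)$ with $(y,t-)$ and $(x,t+)$ with $(y,t+)$). Choose arbitrarily an orientation of each loop, and let $\ell_x^+(\gamma)$ (resp. $\ell_x^-(\gamma)$) be the total length of the vertical elements of $\gamma$ at site $x$ that move up (resp. down). Set $$w(\gamma)=\sum_{a=-S}^{S}\exp\Bigl\{a\sum_{x\in\Lambda}h_x\bigl[\ell_x^+(\gamma)-\ell_x^-(\gamma)\bigr]\Bigr\}.$$ Then, whatever the choice of orientations, $\omega\mapsto\prod_{\gamma\in\mathcal L(\omega)}w(\gamma)$ is $\rho$-integrable and $$\tilde Z^{(u)}(\beta,\Lambda,\boldsymbol h)=\int\rho(\mathrm d\omega)\prod_{\gamma\in\mathcal L(\omega)}w(\gamma).$$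 -/

import Mathlib

open MeasureTheory

namespace RandomLoop

noncomputable section

/-! ### The quantum spin model -/

/-- The spin values `{-S, …, S}` (integer spin `S`). -/
abbrev Spin (S : ℕ) : Type := {a : ℤ // a ∈ Finset.Icc (-(S : ℤ)) (S : ℤ)}

/-- Classical configurations `σ ∈ {-S, …, S}^Λ`; they index the orthonormal basis `|σ⟩` of the
Hilbert space `⨂_{x ∈ Λ} ℂ^(2S+1)`.  Operators are given by their matrices in this basis. -/
abbrev Config (V : Type*) (S : ℕ) : Type _ := V → Spin S

/-- `⟨a,b| T |c,d⟩`, where `T |c,d⟩ = |d,c⟩`. -/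
def swapOp (S : ℕ) : Matrix (Spin S × Spin S) (Spin S × Spin S) ℂ :=
  fun p q => if p.1 = q.2 ∧ p.2 = q.1 then 1 else 0

/-- `⟨a,b| P |c,d⟩ = (-1)^(a-c) δ_{a,-b} δ_{c,-d}`. -/
def singletOp (S : ℕ) : Matrix (Spin S × Spin S) (Spin S × Spin S) ℂ :=
  fun p q => if (p.1 : ℤ) = -(p.2 : ℤ) ∧ (q.1 : ℤ) = -(q.2 : ℤ)
    then (-1 : ℂ) ^ ((p.1 : ℤ) - (q.1 : ℤ)) else 0

/-- The extension `M_{xy} ⊗ Id_{Λ∖{x,y}}` of a two-site operator `M` (for `x ≠ y`). -/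
def twoSite {V : Type*} [Fintype V] [DecidableEq V] {S : ℕ}
    (M : Matrix (Spin S × Spin S) (Spin S × Spin S) ℂ) (x y : V) :
    Matrix (Config V S) (Config V S) ℂ :=
  fun σ τ => if ∀ z, z ≠ x → z ≠ y → σ z = τ z then M (σ x, σ y) (τ x, τ y) else 0

theorem twoSite_comm {V : Type*} [Fintype V] [DecidableEq V] {S : ℕ}
    (M : Matrix (Spin S × Spin S) (Spin S × Spin S) ℂ)
    (hM : ∀ p q, M p.swap q.swap = M p q) (x y : V) : twoSite M x y = twoSite M y x := by
  funext σ τ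
  have h : (∀ z, z ≠ x → z ≠ y → σ z = τ z) ↔ (∀ z, z ≠ y → z ≠ x → σ z = τ z) :=
    forall_congr' fun z => ⟨fun h a b => h b a, fun h a b => h b a⟩
  have h2 : M (σ x, σ y) (τ x, τ y) = M (σ y, σ x) (τ y, τ x) := hM (σ y, σ x) (τ y, τ x)
  simp only [twoSite, h, h2]

theorem swapOp_swap (S : ℕ) (p q : Spin S × Spin S) :
    swapOp S p.swap q.swap = swapOp S p q := by
  simp only [swapOp, Prod.fst_swap, Prod.snd_swap, and_comm]

theorem singletOp_swap (S : ℕ) (p q : Spin S × Spin S) :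
    singletOp S p.swap q.swap = singletOp S p q := by
  obtain ⟨a, b⟩ := p
  obtain ⟨c, d⟩ := q
  simp only [singletOp, Prod.swap_prod_mk]
  by_cases h : (a : ℤ) = -(b : ℤ) ∧ (c : ℤ) = -(d : ℤ)
  · have h' : (b : ℤ) = -(a : ℤ) ∧ (d : ℤ) = -(c : ℤ) := by omega
    rw [if_pos h, if_pos h', h'.1, h'.2,
      show -(a : ℤ) - -(c : ℤ) = -((a : ℤ) - (c : ℤ)) by ring, zpow_neg, ← inv_zpow]
    norm_num
  · have h' : ¬ ((b : ℤ) = -(a : ℤ) ∧ (d : ℤ) = -(c : ℤ)) := by omega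
    rw [if_neg h, if_neg h']

/-- The operator `T_{xy}` on the full space, for the unordered pair `e = {x,y}`. -/
def T {V : Type*} [Fintype V] [DecidableEq V] (S : ℕ) (e : Sym2 V) :
    Matrix (Config V S) (Config V S) ℂ :=
  Sym2.lift ⟨fun x y => twoSite (swapOp S) x y, twoSite_comm _ (swapOp_swap S)⟩ e

/-- The operator `P_{xy}` on the full space, for the unordered pair `e = {x,y}`. -/
def P {V : Type*} [Fintype V] [DecidableEq V] (S : ℕ) (e : Sym2 V) :
    Matrix (Config V S) (Config V S) ℂ :=
  Sym2.lift ⟨fun x y => twoSite (singletOp S) x y, twoSite_comm _ (singletOp_swap S)⟩ e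

/-- The operator `S_x^3`, with `S_x^3 |σ⟩ = σ_x |σ⟩`. -/
def spin3 {V : Type*} [Fintype V] [DecidableEq V] (S : ℕ) (x : V) :
    Matrix (Config V S) (Config V S) ℂ :=
  Matrix.diagonal fun σ => ((σ x : ℤ) : ℂ)

/-- The Hamiltonian `H̃ = -∑_{e ∈ E} (u T_e + (1-u) P_e - 1) - ∑_x h_x S_x^3`. -/
def hamiltonian {V : Type*} [Fintype V] [DecidableEq V] (G : SimpleGraph V)
    [DecidableRel G.Adj] (S : ℕ) (u : ℝ) (h : V → ℝ) :
    Matrix (Config V S) (Config V S) ℂ :=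
  -(∑ e ∈ G.edgeFinset, ((u : ℂ) • T S e + ((1 - u : ℝ) : ℂ) • P S e - 1))
    - ∑ x, (h x : ℂ) • spin3 S x

/-- The partition function `Z̃ = Tr exp(-β H̃)`. -/
def partitionFunction {V : Type*} [Fintype V] [DecidableEq V] (G : SimpleGraph V)
    [DecidableRel G.Adj] (S : ℕ) (u β : ℝ) (h : V → ℝ) : ℂ :=
  (NormedSpace.exp (-((β : ℂ) • hamiltonian G S u h))).trace

/-! ### The Poisson point measures -/

/-- The law of the Poisson point process with finite intensity measure `ν`: the number of points
is Poisson of parameter `ν(X)` and, given that there are `n` of them, they are independent with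
law `ν / ν(X)`.  In other words
`∫ F dρ = ∑_n e^{-ν(X)} / n! ∫ F(x_1, …, x_n) ν(dx_1) ⋯ ν(dx_n)`.
A realization is given as an enumeration of its points. -/
def poissonLaw {X : Type*} [MeasurableSpace X] (ν : Measure X) :
    Measure (Σ n : ℕ, Fin n → X) :=
  Measure.sum fun n =>
    ENNReal.ofReal (Real.exp (-(ν.real Set.univ)) / (n.factorial : ℝ)) •
      (Measure.pi fun _ : Fin n => ν).map (fun x => ⟨n, x⟩)

/-- The two kinds of transitions. -/
inductive Kind : Type
  | cross
  | bar

instance : MeasurableSpace Kind := ⊤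

instance {V : Type*} (G : SimpleGraph V) : MeasurableSpace G.edgeSet := ⊤

/-- A transition: an edge, a kind, and a time. -/
abbrev Event {V : Type*} (G : SimpleGraph V) : Type _ := G.edgeSet × Kind × ℝ

/-- A realization `ω`: finitely many transitions. -/
abbrev Realization {V : Type*} (G : SimpleGraph V) : Type _ := Σ n : ℕ, Fin n → Event G

/-- The intensity on `E × {cross, bar} × [0,β]`: at each edge, crosses occur with intensity `u`
and double bars with intensity `1-u`. -/
def intensity {V : Type*} (G : SimpleGraph V) (u β : ℝ) : Measure (Event G) :=
  Measure.count.prod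
    ((ENNReal.ofReal u • Measure.dirac Kind.cross +
        ENNReal.ofReal (1 - u) • Measure.dirac Kind.bar).prod
      (volume.restrict (Set.Icc 0 β)))

/-- The measure `ρ(dω)` of independent Poisson point measures. -/
def rho {V : Type*} (G : SimpleGraph V) (u β : ℝ) : Measure (Realization G) :=
  poissonLaw (intensity G u β)

/-! ### Loops -/

/-- No transition of `ω` touches the site `x` at a time belonging to `I`. -/
def Clear {V : Type*} {G : SimpleGraph V} (ω : Realization G) (x : V) (I : Set ℝ) : Prop :=
  ∀ i : Fin ω.1, x ∈ ((ω.2 i).1 : Sym2 V) → (ω.2 i).2.2 ∉ I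

/-- `ω` has a transition of kind `k` at the edge `{x,y}` and time `r`. -/
def HasEvent {V : Type*} {G : SimpleGraph V} (ω : Realization G) (k : Kind) (x y : V)
    (r : ℝ) : Prop :=
  ∃ i : Fin ω.1, ((ω.2 i).1 : Sym2 V) = s(x, y) ∧ (ω.2 i).2.1 = k ∧ (ω.2 i).2.2 = r

/-- Points `(x,t)` of the vertical lines `Λ × (0,β)`, away from the end points of transitions. -/
abbrev Point {V : Type*} {G : SimpleGraph V} (β : ℝ) (ω : Realization G) : Type _ :=
  {p : V × ℝ // p.2 ∈ Set.Ioo 0 β ∧ Clear ω p.1 {p.2}}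

/-- Elementary displacements along an oriented loop.  A pair `(p, d)` is a space-time point `p`
visited in the vertical direction `d`, with `true` for up and `false` for down.
* `vertical`: the vertical line is followed, without meeting a transition;
* `periodic`: the vertical line is followed through time `β = 0`;
* `cross`: a cross at `{x,y} × r` joins `(x, r-)` and `(y, r+)`, the vertical direction is kept;
* `barBelow`, `barAbove`: a double bar at `{x,y} × r` joins `(x, r-)` and `(y, r-)`, and joins
  `(x, r+)` and `(y, r+)`; the vertical direction is reversed.
The converse displacements are accounted for by generating an equivalence relation. -/
inductive Step {V : Type*} {G : SimpleGraph V} (β : ℝ) (ω : Realization G) :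
    Point β ω × Bool → Point β ω × Bool → Prop
  | vertical (p q : Point β ω) (d : Bool) : p.1.1 = q.1.1 →
      Clear ω p.1.1 (Set.uIcc p.1.2 q.1.2) → Step β ω (p, d) (q, d)
  | periodic (p q : Point β ω) (d : Bool) : p.1.1 = q.1.1 →
      Clear ω p.1.1 (Set.Icc p.1.2 β) → Clear ω p.1.1 (Set.Icc 0 q.1.2) →
      Step β ω (p, d) (q, d)
  | cross (p q : Point β ω) (d : Bool) (r : ℝ) : HasEvent ω Kind.cross p.1.1 q.1.1 r →
      p.1.2 < r → r < q.1.2 →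
      Clear ω p.1.1 (Set.Ico p.1.2 r) → Clear ω q.1.1 (Set.Ioc r q.1.2) →
      Step β ω (p, d) (q, d)
  | barBelow (p q : Point β ω) (d : Bool) (r : ℝ) : HasEvent ω Kind.bar p.1.1 q.1.1 r →
      p.1.2 < r → q.1.2 < r →
      Clear ω p.1.1 (Set.Ico p.1.2 r) → Clear ω q.1.1 (Set.Ico q.1.2 r) →
      Step β ω (p, d) (q, !d)
  | barAbove (p q : Point β ω) (d : Bool) (r : ℝ) : HasEvent ω Kind.bar p.1.1 q.1.1 r →
      r < p.1.2 → r < q.1.2 →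
      Clear ω p.1.1 (Set.Ioc r p.1.2) → Clear ω q.1.1 (Set.Ioc r q.1.2) →
      Step β ω (p, d) (q, !d)

/-- Oriented loops: classes of the equivalence relation generated by `Step`. -/
def OrientedLoop {V : Type*} {G : SimpleGraph V} (β : ℝ) (ω : Realization G) : Type _ :=
  Quot (Step β ω)

/-- The set of loops `L(ω)`: classes of space-time points, the directions being forgotten. -/
def Loop {V : Type*} {G : SimpleGraph V} (β : ℝ) (ω : Realization G) : Type _ :=
  Quot fun p q : Point β ω => ∃ d d' : Bool, Step β ω (p, d) (q, d')

/-- The loop underlying an oriented loop. -/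
def OrientedLoop.forget {V : Type*} {G : SimpleGraph V} {β : ℝ} {ω : Realization G}
    (γ : OrientedLoop β ω) : Loop β ω :=
  Quot.map Prod.fst (fun a b hab => ⟨a.2, b.2, hab⟩) γ

/-- There are finitely many loops. -/
instance {V : Type*} [Finite V] {G : SimpleGraph V} (β : ℝ) (ω : Realization G) :
    Finite (Loop β ω) := by
  classical
  let code : Point β ω → V × Set (Fin ω.1) := fun p =>
    (p.1.1, {i | p.1.1 ∈ ((ω.2 i).1 : Sym2 V) ∧ (ω.2 i).2.2 < p.1.2})
  have hcode : ∀ p q, code p = code q → (Quot.mk _ p : Loop β ω) = Quot.mk _ q := by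
    intro p q hpq
    have h1 : p.1.1 = q.1.1 := congrArg (fun c => c.1) hpq
    have h2 : ∀ i, (p.1.1 ∈ ((ω.2 i).1 : Sym2 V) ∧ (ω.2 i).2.2 < p.1.2) ↔
        (q.1.1 ∈ ((ω.2 i).1 : Sym2 V) ∧ (ω.2 i).2.2 < q.1.2) :=
      fun i => Set.ext_iff.1 (congrArg (fun c => c.2) hpq) i
    refine Quot.sound ⟨true, true, Step.vertical p q true h1 ?_⟩
    intro i hi hmem
    have hp : (ω.2 i).2.2 ≠ p.1.2 := fun h => p.2.2 i hi h
    have hq : (ω.2 i).2.2 ≠ q.1.2 := fun h => q.2.2 i (h1 ▸ hi) h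
    have h3 := h2 i
    rw [← h1] at h3
    simp only [hi, true_and] at h3
    rcases Set.mem_uIcc.1 hmem with ⟨ha, hb⟩ | ⟨ha, hb⟩
    · exact absurd (h3.2 (lt_of_le_of_ne hb hq)) (not_lt.2 ha)
    · exact absurd (h3.1 (lt_of_le_of_ne hb hp)) (not_lt.2 ha)
  refine Finite.of_surjective
    (fun c : Set.range code => (Quot.mk _ c.2.choose : Loop β ω)) ?_
  intro γ
  induction γ using Quot.ind with
  | mk p =>
    exact ⟨⟨code p, p, rfl⟩, hcode _ _ (Exists.choose_spec (⟨p, rfl⟩ : code p ∈ Set.range code))⟩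

/-- `ℓ_x^+(γ)` (`d = true`) and `ℓ_x^-(γ)` (`d = false`): the vertical length of the elements of
the oriented loop `γ` at the site `x` that move up, resp. down. -/
def OrientedLoop.length {V : Type*} {G : SimpleGraph V} {β : ℝ} {ω : Realization G}
    (γ : OrientedLoop β ω) (x : V) (d : Bool) : ℝ :=
  volume.real {t : ℝ | ∃ ht : t ∈ Set.Ioo 0 β ∧ Clear ω x {t},
    (Quot.mk _ (⟨(x, t), ht⟩, d) : OrientedLoop β ω) = γ}

/-- The weight `w(γ) = ∑_{a=-S}^{S} exp {a ∑_x h_x [ℓ_x^+(γ) - ℓ_x^-(γ)]}`. -/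
def weight {V : Type*} [Fintype V] {G : SimpleGraph V} {β : ℝ} {ω : Realization G}
    (S : ℕ) (h : V → ℝ) (γ : OrientedLoop β ω) : ℝ :=
  ∑ a ∈ Finset.Icc (-(S : ℤ)) (S : ℤ),
    Real.exp ((a : ℝ) * ∑ x, h x * (γ.length x true - γ.length x false))

end

end RandomLoop

/-! The signs in `P` are a pure gauge. With g(σ) = (-1)^⌊m/2⌋, m being the number of odd spins of σ,
every nonzero entry of a singlet operator between σ and τ equals g(σ)g(τ), while a transposition
preserves g. Conjugation by the diagonal matrix g therefore turns -βH̃ into the real matrix β(field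
+ K) - β|E|, where K has nonnegative entries. The trace does not see the conjugation
(`partitionFunction_eq`).

Expanding exp β(field + K) in K gives a convergent series of integrals over ordered transition times
(`hasSum_dyson`). Averaging over the Poisson law produces the same series: its factor e^{-β|E|} is
the constant above, its 1/n! cancels the n! orderings of n transitions, and the intensities u and 1
- u are the coefficients in K. So the partition function is the ρ-average of the trace of the
time-ordered product `evolution` (`lintegral_trace_evolution`). All terms are nonnegative, so this
runs in `ENNReal` and yields integrability at the end.

It remains to evaluate that trace for one realization with distinct times in (0,β), which is almost
every one. It is a sum over configurations that are constant between transitions, periodic in time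
and allowed at each transition, weighted by the exponential of the time integral of the field
(`evolution_eq_sum`). Such a configuration is allowed exactly when the spin, counted with a minus
sign where the motion is downwards, is constant along loops: a cross carries the spin to the other
site, and a double bar reverses both direction and spin. Once loops are oriented, allowed
configurations are thus the free choices of one spin per loop, the field integral is a sum over
loops, and the sum factorizes into the weights (`trace_evolution`).

A free choice is possible only if no loop runs through the same vertical element in both directions.
Motion along the loops is a permutation of the finitely many directed vertical elements, namely a
product of two involutions without fixed points (direction reversal and passage through a junction);
for such a product, an element and its reversal never share a cycle (`not_sameCycle_involution`). -/

set_option linter.unusedSectionVars false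

namespace RandomLoop

noncomputable section

/-! ### The Dyson series -/

section Dyson

variable {ι : Type*} [Fintype ι] [DecidableEq ι]

/-- The terms of the Dyson series of `exp (t (diagonal b + K))`, as a perturbation of
`exp (t diagonal b)`. -/
def dyson (b : ι → ℝ) (K : Matrix ι ι ℝ) : ℕ → ℝ → ι → ι → ℝ
  | 0, t, σ, τ => if σ = τ then Real.exp (t * b σ) else 0
  | n + 1, t, σ, τ =>
      ∫ s in (0 : ℝ)..t, Real.exp ((t - s) * b σ) * ∑ σ', K σ σ' * dyson b K n s σ' τ

/-- Moves the upper limit out of the integrand, so that continuity of primitives and the fundamental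
theorem of calculus apply. -/
theorem integral_exp_sub_mul (c t : ℝ) (f : ℝ → ℝ) :
    ∫ s in (0 : ℝ)..t, Real.exp ((t - s) * c) * f s =
      Real.exp (t * c) * ∫ s in (0 : ℝ)..t, Real.exp (-s * c) * f s := by
  rw [← intervalIntegral.integral_const_mul]
  congr 1
  funext s
  rw [← mul_assoc, ← Real.exp_add]
  congr 2
  ring

theorem continuous_mul_sum_mul {κ : Type*} [Fintype κ] {f : ℝ → ℝ} (hf : Continuous f) (k : κ → ℝ)
    {g : κ → ℝ → ℝ} (hg : ∀ i, Continuous (g i)) :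
    Continuous fun s => f s * ∑ i, k i * g i s := by
  fun_prop

theorem continuous_dyson (b : ι → ℝ) (K : Matrix ι ι ℝ) (n : ℕ) (σ τ : ι) :
    Continuous fun t => dyson b K n t σ τ := by
  induction n generalizing σ τ with
  | zero =>
    simp only [dyson]
    split_ifs
    · fun_prop
    · exact continuous_const
  | succ n ih =>
    simp only [dyson, integral_exp_sub_mul]
    have hc : Continuous fun s => Real.exp (-s * b σ) * ∑ σ', K σ σ' * dyson b K n s σ' τ :=
      continuous_mul_sum_mul (by fun_prop) _ fun σ' => ih σ' τ
    exact (by fun_prop : Continuous fun t => Real.exp (t * b σ)).mul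
      (intervalIntegral.continuous_primitive (fun _ _ => hc.intervalIntegrable _ _) 0)

theorem dyson_nonneg {b : ι → ℝ} {K : Matrix ι ι ℝ} (hK : ∀ σ σ', 0 ≤ K σ σ') (n : ℕ) {t : ℝ}
    (ht : 0 ≤ t) (σ τ : ι) : 0 ≤ dyson b K n t σ τ := by
  induction n generalizing t σ τ with
  | zero =>
    simp only [dyson]
    split_ifs <;> positivity
  | succ n ih =>
    refine intervalIntegral.integral_nonneg ht fun s hs => ?_
    exact mul_nonneg (Real.exp_nonneg _)
      (Finset.sum_nonneg fun σ' _ => mul_nonneg (hK _ _) (ih hs.1 _ _))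

theorem hasDerivAt_exp_smul_entry (A : Matrix ι ι ℝ) (t : ℝ) (σ τ : ι) :
    HasDerivAt (fun s : ℝ => NormedSpace.exp (s • A) σ τ)
      ((A * NormedSpace.exp (t • A)) σ τ) t := by
  let _ : NormedRing (Matrix ι ι ℝ) := Matrix.linftyOpNormedRing
  let _ : NormedAlgebra ℝ (Matrix ι ι ℝ) := Matrix.linftyOpNormedAlgebra
  have h := hasDerivAt_exp_smul_const' (𝕂 := ℝ) A t
  exact (hasDerivAt_pi.1 ((hasDerivAt_pi.1 h) σ)) τ

theorem continuous_exp_smul_entry (A : Matrix ι ι ℝ) (σ τ : ι) :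
    Continuous fun s : ℝ => NormedSpace.exp (s • A) σ τ :=
  continuous_iff_continuousAt.2 fun t => (hasDerivAt_exp_smul_entry A t σ τ).continuousAt

/-- Duhamel's formula. -/
theorem exp_entry_eq_duhamel (b : ι → ℝ) (K : Matrix ι ι ℝ) (t : ℝ) (σ τ : ι) :
    NormedSpace.exp (t • (Matrix.diagonal b + K)) σ τ =
      (if σ = τ then Real.exp (t * b σ) else 0) +
      ∫ s in (0 : ℝ)..t, Real.exp ((t - s) * b σ) *
        ∑ σ', K σ σ' * NormedSpace.exp (s • (Matrix.diagonal b + K)) σ' τ := by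
  set A := Matrix.diagonal b + K with hA
  -- The integrating factor e^{-s b σ} cancels the diagonal part of the derivative and leaves only
  -- the `K` term.
  have hd : ∀ s : ℝ, HasDerivAt (fun s : ℝ => Real.exp (-s * b σ) * NormedSpace.exp (s • A) σ τ)
      (Real.exp (-s * b σ) * ∑ σ', K σ σ' * NormedSpace.exp (s • A) σ' τ) s := by
    intro s
    have h1 : HasDerivAt (fun s : ℝ => Real.exp (-s * b σ)) (Real.exp (-s * b σ) * (-1 * b σ)) s :=
      ((hasDerivAt_id s).neg.mul_const (b σ)).exp
    convert! h1.mul (hasDerivAt_exp_smul_entry A s σ τ) using 1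
    rw [hA, add_mul, Matrix.add_apply, Matrix.diagonal_mul, Matrix.mul_apply, ← hA]
    ring
  have hcont : Continuous fun s : ℝ =>
      Real.exp (-s * b σ) * ∑ σ', K σ σ' * NormedSpace.exp (s • A) σ' τ :=
    continuous_mul_sum_mul (by fun_prop) _ fun σ' => continuous_exp_smul_entry A σ' τ
  rw [integral_exp_sub_mul,
    intervalIntegral.integral_eq_sub_of_hasDerivAt (fun s _ => hd s)
      (hcont.intervalIntegrable _ _), mul_sub, ← mul_assoc, ← Real.exp_add]
  simp only [zero_smul, NormedSpace.exp_zero, Matrix.one_apply]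
  split_ifs with hστ <;> simp

/-- The exponential and the partial sums satisfy the same Duhamel recursion with the same zeroth
term, so the remainder satisfies it with no inhomogeneous term. -/
theorem sub_sum_dyson_succ (b : ι → ℝ) (K : Matrix ι ι ℝ) (N : ℕ) (t : ℝ) (σ τ : ι) :
    NormedSpace.exp (t • (Matrix.diagonal b + K)) σ τ -
        ∑ n ∈ Finset.range (N + 1), dyson b K n t σ τ =
      ∫ s in (0 : ℝ)..t, Real.exp ((t - s) * b σ) * ∑ σ', K σ σ' *
        (NormedSpace.exp (s • (Matrix.diagonal b + K)) σ' τ -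
          ∑ n ∈ Finset.range N, dyson b K n s σ' τ) := by
  have hc : Continuous fun s : ℝ => Real.exp ((t - s) * b σ) := by fun_prop
  rw [Finset.sum_range_succ', exp_entry_eq_duhamel]
  simp only [dyson]
  rw [← intervalIntegral.integral_finsetSum,
    show ∀ a x y : ℝ, a + x - (y + a) = x - y from fun a x y => by ring,
    ← intervalIntegral.integral_sub]
  · congr 1
    funext s
    rw [← Finset.mul_sum, ← mul_sub, Finset.sum_comm, ← Finset.sum_sub_distrib]
    simp only [← Finset.mul_sum, ← mul_sub]
  · exact (continuous_mul_sum_mul hc _ fun σ' =>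
      continuous_exp_smul_entry _ σ' τ).intervalIntegrable _ _
  · exact (continuous_finsetSum _ fun n _ => continuous_mul_sum_mul hc _ fun σ' =>
      continuous_dyson b K n σ' τ).intervalIntegrable _ _
  · exact fun n _ => (continuous_mul_sum_mul hc _ fun σ' =>
      continuous_dyson b K n σ' τ).intervalIntegrable _ _

/-- Iterating the recursion for the remainder costs a factor `L` and one time integration per step;
the nested integrations produce the factorial. -/
theorem abs_sub_sum_dyson_le (b : ι → ℝ) (K : Matrix ι ι ℝ) {T : ℝ} {C L : ℝ}
    (hC : ∀ t ∈ Set.Icc 0 T, ∀ σ τ,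
      |NormedSpace.exp (t • (Matrix.diagonal b + K)) σ τ| ≤ C)
    (hL : ∀ σ, Real.exp (T * |b σ|) * ∑ σ', |K σ σ'| ≤ L) (N : ℕ) {t : ℝ}
    (ht : t ∈ Set.Icc 0 T) (σ τ : ι) :
    |NormedSpace.exp (t • (Matrix.diagonal b + K)) σ τ -
        ∑ n ∈ Finset.range N, dyson b K n t σ τ| ≤ C * (L * t) ^ N / N.factorial := by
  induction N generalizing t σ τ with
  | zero => simpa using hC t ht σ τ
  | succ N ih =>
    have hC0 : 0 ≤ C := (abs_nonneg _).trans (hC t ht σ τ)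
    have hL0 : 0 ≤ L := le_trans (by positivity) (hL σ)
    rw [sub_sum_dyson_succ, ← Real.norm_eq_abs]
    have hint : ∫ s in (0 : ℝ)..t, L * (C * (L * s) ^ N / N.factorial) =
        C * (L * t) ^ (N + 1) / (N + 1).factorial := by
      have : ∀ s : ℝ, L * (C * (L * s) ^ N / N.factorial) =
          (C * L ^ (N + 1) / N.factorial) * s ^ N := by
        intro s; ring
      simp only [this, intervalIntegral.integral_const_mul, integral_pow]
      rw [Nat.factorial_succ]
      push_cast
      have : (N.factorial : ℝ) ≠ 0 := by positivity
      field_simp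
      ring
    rw [← hint]
    refine intervalIntegral.norm_integral_le_of_norm_le ht.1 (Filter.Eventually.of_forall ?_)
      (Continuous.intervalIntegrable (by fun_prop) _ _)
    intro s hs
    have hs' : s ∈ Set.Icc 0 T := ⟨hs.1.le, hs.2.trans ht.2⟩
    have hM : 0 ≤ C * (L * s) ^ N / N.factorial :=
      div_nonneg (mul_nonneg hC0 (pow_nonneg (mul_nonneg hL0 hs'.1) _)) (by positivity)
    rw [Real.norm_eq_abs, abs_mul, Real.abs_exp]
    refine le_trans ?_ (mul_le_mul_of_nonneg_right (hL σ) hM)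
    rw [mul_assoc]
    refine mul_le_mul ?_ ?_ (abs_nonneg _) (Real.exp_nonneg _)
    · refine Real.exp_le_exp.2 ?_
      calc (t - s) * b σ ≤ (t - s) * |b σ| :=
            mul_le_mul_of_nonneg_left (le_abs_self _) (by linarith [hs.2])
        _ ≤ T * |b σ| := mul_le_mul_of_nonneg_right (by linarith [hs.1, ht.2]) (abs_nonneg _)
    · refine (Finset.abs_sum_le_sum_abs _ _).trans ?_
      rw [Finset.sum_mul]
      refine Finset.sum_le_sum fun σ' _ => ?_
      rw [abs_mul]
      exact mul_le_mul_of_nonneg_left (ih hs' σ' τ) (abs_nonneg _)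

/-- Nonnegativity of the terms reduces summability to convergence of the partial sums, where the
factorial remainder bound applies. Compactness of the time interval supplies `C`. -/
theorem hasSum_dyson {b : ι → ℝ} {K : Matrix ι ι ℝ} (hK : ∀ σ σ', 0 ≤ K σ σ') {t : ℝ}
    (ht : 0 ≤ t) (σ τ : ι) :
    HasSum (fun n => dyson b K n t σ τ)
      (NormedSpace.exp (t • (Matrix.diagonal b + K)) σ τ) := by
  rw [hasSum_iff_tendsto_nat_of_nonneg (fun n => dyson_nonneg hK n ht σ τ)]
  set A := Matrix.diagonal b + K
  obtain ⟨C, hC⟩ := (isCompact_Icc (a := (0 : ℝ)) (b := t)).exists_bound_of_continuousOn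
    (f := fun (s : ℝ) (p : ι × ι) => NormedSpace.exp (s • A) p.1 p.2)
    (continuous_pi fun p : ι × ι => continuous_exp_smul_entry A p.1 p.2).continuousOn
  have hC' : ∀ s ∈ Set.Icc 0 t, ∀ σ τ, |NormedSpace.exp (s • A) σ τ| ≤ C := fun s hs σ τ =>
    (norm_le_pi_norm (fun p : ι × ι => NormedSpace.exp (s • A) p.1 p.2) (σ, τ)).trans (hC s hs)
  have hL : ∀ σ, Real.exp (t * |b σ|) * ∑ σ', |K σ σ'| ≤
      ∑ σ, Real.exp (t * |b σ|) * ∑ σ', |K σ σ'| := fun σ =>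
    Finset.single_le_sum (f := fun σ => Real.exp (t * |b σ|) * ∑ σ', |K σ σ'|)
      (fun _ _ => by positivity) (Finset.mem_univ σ)
  rw [tendsto_iff_norm_sub_tendsto_zero]
  have hlim := (FloorSemiring.tendsto_pow_div_factorial_atTop
    ((∑ σ, Real.exp (t * |b σ|) * ∑ σ', |K σ σ'|) * t)).const_mul C
  rw [mul_zero] at hlim
  refine squeeze_zero (fun _ => norm_nonneg _) (fun N => ?_) hlim
  rw [norm_sub_rev, Real.norm_eq_abs, ← mul_div_assoc]
  exact abs_sub_sum_dyson_le b K hC' hL N ⟨ht, le_rfl⟩ σ τ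

end Dyson

/-! ### Removal of the signs -/

section Gauge

variable {V : Type*} [Fintype V] [DecidableEq V] {S : ℕ}

/-- The transposition of the two sites of an edge. -/
def edgeSwap (e : Sym2 V) : Equiv.Perm V :=
  Sym2.lift ⟨fun x y => Equiv.swap x y, fun x y => Equiv.swap_comm x y⟩ e

@[simp] theorem edgeSwap_mk (x y : V) : edgeSwap s(x, y) = Equiv.swap x y := rfl

/-- The pairs `(σ, τ)` of configurations above and below a transition at the edge `e`. -/
def Rel (e : Sym2 V) : Kind → Config V S → Config V S → Prop
  | Kind.cross, σ, τ => ∀ x, σ (edgeSwap e x) = τ x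
  | Kind.bar, σ, τ => (∀ x, x ∉ e → σ x = τ x) ∧
      ∀ x ∈ e, (σ (edgeSwap e x) : ℤ) = -(σ x : ℤ) ∧ (τ (edgeSwap e x) : ℤ) = -(τ x : ℤ)

/-- Half of the number of odd spins, rounded down. -/
def oddPairs (σ : Config V S) : ℕ := (∑ x, ((σ x : ℤ) % 2).toNat) / 2

/-- The sign that intertwines the singlet operators with their entrywise absolute values. -/
def gauge (σ : Config V S) : ℂ := (-1) ^ oddPairs σ

theorem gauge_mul_self (σ : Config V S) : gauge σ * gauge σ = 1 := by
  rw [gauge, ← mul_pow]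
  norm_num

open Classical in
theorem T_apply (e : Sym2 V) (he : ¬ e.IsDiag) (σ τ : Config V S) :
    T S e σ τ = if Rel e Kind.cross σ τ then 1 else 0 := by
  induction e using Sym2.ind with
  | _ x y =>
    have hxy : x ≠ y := fun h => he (by simpa using h)
    have : Rel s(x, y) Kind.cross σ τ ↔
        (∀ z, z ≠ x → z ≠ y → σ z = τ z) ∧ σ x = τ y ∧ σ y = τ x := by
      simp only [Rel, edgeSwap_mk]
      constructor
      · intro h
        refine ⟨fun z hx hy => ?_, ?_, ?_⟩
        · simpa [Equiv.swap_apply_of_ne_of_ne hx hy] using h z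
        · simpa using h y
        · simpa using h x
      · rintro ⟨h, h1, h2⟩ z
        by_cases hx : z = x
        · subst hx; simpa using h2
        by_cases hy : z = y
        · subst hy; simpa using h1
        rw [Equiv.swap_apply_of_ne_of_ne hx hy]
        exact h z hx hy
    simp only [T, Sym2.lift_mk, twoSite, swapOp, this]
    split_ifs <;> simp_all

-- The two spins on the edge are opposite, hence of equal parity: they add 0 or 2 to the number of
-- odd spins, and so 0 or 1 to its half. Off the edge σ and τ agree, so the two gauge signs multiply
-- to the sign of the singlet entry.
open Classical in
theorem P_apply (e : Sym2 V) (he : ¬ e.IsDiag) (σ τ : Config V S) :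
    P S e σ τ = if Rel e Kind.bar σ τ then gauge σ * gauge τ else 0 := by
  induction e using Sym2.ind with
  | _ x y =>
    have hxy : x ≠ y := fun h => he (by simpa using h)
    have hrel : Rel s(x, y) Kind.bar σ τ ↔
        (∀ z, z ≠ x → z ≠ y → σ z = τ z) ∧
          ((σ x : ℤ) = -(σ y : ℤ) ∧ (τ x : ℤ) = -(τ y : ℤ)) := by
      simp only [Rel, edgeSwap_mk, Sym2.mem_iff, forall_eq_or_imp, forall_eq,
        Equiv.swap_apply_left, Equiv.swap_apply_right, not_or, and_imp]
      constructor
      · rintro ⟨h, ⟨h1, h2⟩, -⟩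
        exact ⟨h, by omega, by omega⟩
      · rintro ⟨h, h1, h2⟩
        exact ⟨h, ⟨by omega, by omega⟩, by omega, by omega⟩
    simp only [P, Sym2.lift_mk, twoSite, singletOp, hrel]
    by_cases h0 : ∀ z, z ≠ x → z ≠ y → σ z = τ z
    swap
    · simp [h0]
    by_cases h1 : (σ x : ℤ) = -(σ y : ℤ) ∧ (τ x : ℤ) = -(τ y : ℤ)
    swap
    · simp [h1]
    rw [if_pos h0, if_pos h1, if_pos ⟨h0, h1⟩]
    have hsum : ∀ σ : Config V S, (∑ z, ((σ z : ℤ) % 2).toNat) =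
        ((σ x : ℤ) % 2).toNat + (((σ y : ℤ) % 2).toNat +
          ∑ z ∈ (Finset.univ.erase x).erase y, ((σ z : ℤ) % 2).toNat) := by
      intro σ
      rw [Finset.add_sum_erase _ (fun z => ((σ z : ℤ) % 2).toNat) (by simp [hxy.symm]),
        Finset.add_sum_erase _ (fun z => ((σ z : ℤ) % 2).toNat) (Finset.mem_univ x)]
    have hrest : ∑ z ∈ (Finset.univ.erase x).erase y, ((σ z : ℤ) % 2).toNat =
        ∑ z ∈ (Finset.univ.erase x).erase y, ((τ z : ℤ) % 2).toNat := by
      refine Finset.sum_congr rfl fun z hz => ?_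
      simp only [Finset.mem_erase, Finset.mem_univ, and_true] at hz
      rw [h0 z hz.2 hz.1]
    have hσ := hsum σ
    have hτ := hsum τ
    rw [hrest] at hσ
    rw [gauge, gauge, ← pow_add, ← zpow_natCast]
    -- The contribution of the other sites, rounded down after halving, occurs once for σ and once
    -- for τ, and so drops out modulo 2.
    have hpar : Even (((σ x : ℤ) - (τ x : ℤ)) - ((oddPairs σ + oddPairs τ : ℕ) : ℤ)) := by
      rw [Int.even_iff, oddPairs, oddPairs]
      omega
    obtain ⟨k, hk⟩ := hpar
    rw [show (σ x : ℤ) - (τ x : ℤ) = ((oddPairs σ + oddPairs τ : ℕ) : ℤ) + 2 * k by omega,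
      zpow_add₀ (by norm_num), zpow_mul]
    norm_num

open Classical in
/-- The entrywise absolute value of `∑_e (u T_e + (1-u) P_e)`. -/
def hopping (G : SimpleGraph V) [DecidableRel G.Adj] (S : ℕ) (u : ℝ) :
    Matrix (Config V S) (Config V S) ℝ :=
  fun σ τ => ∑ e ∈ G.edgeFinset, (u * (if Rel e Kind.cross σ τ then 1 else 0) +
    (1 - u) * (if Rel e Kind.bar σ τ then 1 else 0))

theorem hopping_nonneg (G : SimpleGraph V) [DecidableRel G.Adj] {u : ℝ}
    (hu : u ∈ Set.Icc (0 : ℝ) 1) (σ τ : Config V S) : 0 ≤ hopping G S u σ τ := by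
  refine Finset.sum_nonneg fun e _ => add_nonneg (mul_nonneg hu.1 ?_)
    (mul_nonneg (sub_nonneg.2 hu.2) ?_) <;> split_ifs <;> norm_num

/-- The diagonal part of the Hamiltonian. -/
def field (h : V → ℝ) (σ : Config V S) : ℝ := ∑ x, h x * (σ x : ℤ)

/-- A cross permutes the spins among the sites, which preserves the number of odd ones. -/
theorem gauge_cross {e : Sym2 V} {σ τ : Config V S} (hr : Rel e Kind.cross σ τ) :
    gauge σ = gauge τ := by
  have : oddPairs σ = oddPairs τ := by
    rw [oddPairs, oddPairs, ← Equiv.sum_comp (edgeSwap e) fun x => ((σ x : ℤ) % 2).toNat]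
    simp only [hr _]
  rw [gauge, gauge, this]

/-- Conjugation by the gauge leaves the diagonal and the transpositions unchanged and removes the
signs of the singlets. The constant collects the -1 of each edge. -/
theorem neg_smul_hamiltonian (G : SimpleGraph V) [DecidableRel G.Adj] (u β : ℝ) (h : V → ℝ) :
    -((β : ℂ) • hamiltonian G S u h) =
      Matrix.diagonal gauge *
        (((β • (Matrix.diagonal (field h) + hopping G S u) +
          (-(β * G.edgeFinset.card)) • 1 : Matrix (Config V S) (Config V S) ℝ)).map
            Complex.ofRealHom) * Matrix.diagonal gauge := by
  ext σ τ
  have hg : gauge σ * gauge τ * (1 : Matrix (Config V S) (Config V S) ℂ) σ τ =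
      (1 : Matrix (Config V S) (Config V S) ℂ) σ τ := by
    by_cases hστ : σ = τ
    · subst hστ; simp [gauge_mul_self]
    · simp [hστ]
  have hd : gauge σ * gauge τ * ((Matrix.diagonal (field h) σ τ : ℝ) : ℂ) =
      ∑ x, (h x : ℂ) * spin3 S x σ τ := by
    by_cases hστ : σ = τ
    · subst hστ; simp [gauge_mul_self, field, spin3]
    · simp [hστ, spin3]
  have hk : gauge σ * gauge τ * ((hopping G S u σ τ : ℝ) : ℂ) =
      ∑ e ∈ G.edgeFinset, ((u : ℂ) * T S e σ τ + ((1 - u : ℝ) : ℂ) * P S e σ τ) := by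
    rw [hopping, Complex.ofReal_sum, Finset.mul_sum]
    refine Finset.sum_congr rfl fun e he => ?_
    have hed : ¬ e.IsDiag := G.not_isDiag_of_mem_edgeSet (by simpa using he)
    rw [T_apply e hed, P_apply e hed]
    by_cases h1 : Rel e Kind.cross σ τ <;> by_cases h2 : Rel e Kind.bar σ τ <;>
      simp only [h1, h2, if_true, if_false] <;> push_cast
    · rw [gauge_cross h1, gauge_mul_self]; ring
    · rw [gauge_cross h1, gauge_mul_self]; ring
    · ring
    · ring
  simp only [hamiltonian, Matrix.mul_diagonal, Matrix.diagonal_mul, Matrix.map_apply,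
    Matrix.add_apply, Matrix.smul_apply, Matrix.neg_apply, Matrix.sub_apply, Matrix.sum_apply,
    smul_eq_mul, Complex.ofRealHom_eq_coe, Complex.ofReal_add, Complex.ofReal_mul,
    Complex.ofReal_neg, Complex.ofReal_natCast]
  rw [Finset.sum_sub_distrib, ← hk, ← hd, Finset.sum_const, nsmul_eq_mul]
  have h1 : (((1 : Matrix (Config V S) (Config V S) ℝ) σ τ : ℝ) : ℂ) =
      (1 : Matrix (Config V S) (Config V S) ℂ) σ τ := by
    by_cases hστ : σ = τ
    · subst hστ; simp
    · simp [hστ]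
  rw [h1]
  linear_combination (β * G.edgeFinset.card : ℂ) * hg

theorem partitionFunction_eq (G : SimpleGraph V) [DecidableRel G.Adj] (u β : ℝ) (h : V → ℝ) :
    partitionFunction G S u β h = ((Real.exp (-(β * G.edgeFinset.card)) *
      (NormedSpace.exp (β • (Matrix.diagonal (field h) + hopping G S u) :
        Matrix (Config V S) (Config V S) ℝ)).trace : ℝ) : ℂ) := by
  set A : Matrix (Config V S) (Config V S) ℝ :=
    β • (Matrix.diagonal (field h) + hopping G S u) with hA
  have hD : (Matrix.diagonal gauge : Matrix (Config V S) (Config V S) ℂ) *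
      Matrix.diagonal gauge = 1 := by
    simp [Matrix.diagonal_mul_diagonal, gauge_mul_self]
  have hexp : NormedSpace.exp (A + (-(β * G.edgeFinset.card)) • 1) =
      Real.exp (-(β * G.edgeFinset.card)) • NormedSpace.exp A := by
    rw [Matrix.exp_add_of_commute _ _ ((Commute.one_right A).smul_right _),
      Matrix.smul_one_eq_diagonal, Matrix.exp_diagonal, Pi.exp_def, ← Real.exp_eq_exp_ℝ,
      ← Matrix.smul_one_eq_diagonal, mul_smul_comm, mul_one]
  have hmap : NormedSpace.exp ((A + (-(β * G.edgeFinset.card)) • 1).map Complex.ofRealHom) =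
      (NormedSpace.exp (A + (-(β * G.edgeFinset.card)) • 1)).map Complex.ofRealHom := by
    let _ : NormedRing (Matrix (Config V S) (Config V S) ℝ) := Matrix.linftyOpNormedRing
    let _ : NormedAlgebra ℝ (Matrix (Config V S) (Config V S) ℝ) := Matrix.linftyOpNormedAlgebra
    let _ : NormedRing (Matrix (Config V S) (Config V S) ℂ) := Matrix.linftyOpNormedRing
    let _ : NormedAlgebra ℚ (Matrix (Config V S) (Config V S) ℝ) :=
      NormedAlgebra.restrictScalars ℚ ℝ _
    exact (NormedSpace.map_exp (Complex.ofRealHom.mapMatrix (m := Config V S))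
      (continuous_id.matrix_map Complex.continuous_ofReal) _).symm
  have hU : (Matrix.diagonal gauge : Matrix (Config V S) (Config V S) ℂ)⁻¹ =
      Matrix.diagonal gauge := Matrix.inv_eq_right_inv hD
  have hunit : IsUnit (Matrix.diagonal gauge : Matrix (Config V S) (Config V S) ℂ) :=
    ⟨⟨_, _, hD, hD⟩, rfl⟩
  rw [partitionFunction, neg_smul_hamiltonian, ← hA]
  -- Only the right-hand gauge factor is written as an inverse, to exhibit a conjugation.
  nth_rewrite 2 [← hU]
  rw [Matrix.exp_conj _ _ hunit, hU, Matrix.trace_mul_comm, ← mul_assoc, hD, one_mul, hmap, hexp]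
  simp [Matrix.trace, Finset.mul_sum]

end Gauge

/-! ### Time-ordered products -/

section TimeOrdered

variable {V : Type*} [Fintype V] [DecidableEq V] {S : ℕ} {G : SimpleGraph V}

open Classical in
/-- The time-ordered product of the transitions `ω` during `[0, t]`, in the field `b`. It vanishes
unless the times of the transitions are distinct and smaller than `t`. -/
def evolution (b : Config V S → ℝ) :
    (n : ℕ) → (Fin n → Event G) → ℝ → Config V S → Config V S → ENNReal
  | 0, _, t, σ, τ => if σ = τ then ENNReal.ofReal (Real.exp (t * b σ)) else 0
  | n + 1, ω, t, σ, τ => ∑ i : Fin (n + 1), if (ω i).2.2 < t then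
      ENNReal.ofReal (Real.exp ((t - (ω i).2.2) * b σ)) *
        ∑ σ', (if Rel (ω i).1 (ω i).2.1 σ σ' then 1 else 0) *
          evolution b n (i.removeNth ω) (ω i).2.2 σ' τ
      else 0

open Classical in
theorem measurable_rel (σ σ' : Config V S) :
    Measurable fun x : Event G => if Rel (x.1 : Sym2 V) x.2.1 σ σ' then (1 : ENNReal) else 0 := by
  have : Finite Kind := Finite.of_surjective (fun b : Bool => if b then Kind.cross else Kind.bar)
    (by rintro (_ | _); exacts [⟨true, rfl⟩, ⟨false, rfl⟩])
  have hs : MeasurableSingletonClass Kind := ⟨fun _ => trivial⟩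
  have hs' : MeasurableSingletonClass G.edgeSet := ⟨fun _ => trivial⟩
  exact (measurable_of_countable fun p : G.edgeSet × Kind =>
    if Rel (p.1 : Sym2 V) p.2 σ σ' then (1 : ENNReal) else 0).comp
      (measurable_fst.prodMk measurable_snd.fst)

theorem measurable_evolution (b : Config V S → ℝ) (n : ℕ) (σ τ : Config V S) :
    Measurable fun p : (Fin n → Event G) × ℝ => evolution b n p.1 p.2 σ τ := by
  induction n generalizing σ τ with
  | zero =>
    simp only [evolution]
    split_ifs <;> fun_prop
  | succ n ih =>
    simp only [evolution]
    refine Finset.measurable_sum _ fun i _ => ?_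
    have hi : Measurable fun p : (Fin (n + 1) → Event G) × ℝ => p.1 i :=
      (measurable_pi_apply i).comp measurable_fst
    have hr : Measurable fun p : (Fin (n + 1) → Event G) × ℝ => i.removeNth p.1 :=
      measurable_pi_lambda _ fun j => (measurable_pi_apply _).comp measurable_fst
    refine Measurable.ite (measurableSet_lt hi.snd.snd measurable_snd) ?_ measurable_const
    refine Measurable.mul (by fun_prop) (Finset.measurable_sum _ fun σ' _ => ?_)
    exact ((measurable_rel σ σ').comp hi).mul ((ih σ' τ).comp (hr.prodMk hi.snd.snd))

instance (u β : ℝ) : IsFiniteMeasure (intensity G u β) := by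
  unfold intensity
  have : IsFiniteMeasure (ENNReal.ofReal u • Measure.dirac Kind.cross) :=
    Measure.smul_finite _ ENNReal.ofReal_ne_top
  have : IsFiniteMeasure (ENNReal.ofReal (1 - u) • Measure.dirac Kind.bar) :=
    Measure.smul_finite _ ENNReal.ofReal_ne_top
  infer_instance

open Classical in
theorem lintegral_intensity [DecidableRel G.Adj] (u β : ℝ) {f : Event G → ENNReal}
    (hf : Measurable f) :
    ∫⁻ x, f x ∂(intensity G u β) = ∑ e : G.edgeSet,
      (ENNReal.ofReal u * (∫⁻ s in Set.Icc 0 β, f (e, Kind.cross, s)) +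
        ENNReal.ofReal (1 - u) * (∫⁻ s in Set.Icc 0 β, f (e, Kind.bar, s))) := by
  have : MeasurableSingletonClass G.edgeSet := ⟨fun _ => trivial⟩
  rw [intensity, lintegral_prod _ hf.aemeasurable, lintegral_count, tsum_fintype]
  refine Finset.sum_congr rfl fun e _ => ?_
  have hfe : Measurable fun y : Kind × ℝ => f (e, y) := hf.comp (by fun_prop)
  have hk : ∀ k : Kind, MeasurableSet {k} := fun _ => trivial
  have hs' : MeasurableSingletonClass Kind := ⟨hk⟩
  rw [lintegral_prod _ hfe.aemeasurable, lintegral_add_measure, lintegral_smul_measure,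
    lintegral_smul_measure, lintegral_dirac, lintegral_dirac]
  rfl

theorem intensity_real_univ [DecidableRel G.Adj] {u : ℝ} (hu : u ∈ Set.Icc (0 : ℝ) 1) {β : ℝ}
    (hβ : 0 ≤ β) : (intensity G u β).real Set.univ = β * G.edgeFinset.card := by
  have := lintegral_intensity (G := G) u β (f := fun _ => 1) measurable_const
  simp only [lintegral_const, Measure.restrict_apply_univ, Real.volume_Icc, sub_zero, one_mul,
    Finset.sum_const, nsmul_eq_mul] at this
  rw [Measure.real, this, ← add_mul, ← ENNReal.ofReal_add hu.1 (by linarith [hu.2])]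
  simp [SimpleGraph.edgeFinset_card, ENNReal.toReal_ofReal hβ, mul_comm]

-- Any of the n + 1 points may be the outermost one. The points are exchangeable under the product
-- measure, so all choices contribute equally, and Tonelli splits off the chosen point.
open Classical in
theorem lintegral_evolution_succ (b : Config V S → ℝ) (u β : ℝ) (n : ℕ) (t : ℝ)
    (σ τ : Config V S) :
    ∫⁻ ω, evolution b (n + 1) ω t σ τ ∂(Measure.pi fun _ => intensity G u β) =
      (n + 1) * ∫⁻ x, (if x.2.2 < t then ENNReal.ofReal (Real.exp ((t - x.2.2) * b σ)) *
        ∑ σ', (if Rel (x.1 : Sym2 V) x.2.1 σ σ' then 1 else 0) *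
          ∫⁻ ω, evolution b n ω x.2.2 σ' τ ∂(Measure.pi fun _ => intensity G u β)
        else 0) ∂(intensity G u β) := by
  have hev : ∀ σ', Measurable fun p : Event G × (Fin n → Event G) =>
      evolution b n p.2 p.1.2.2 σ' τ := fun σ' =>
    (measurable_evolution b n σ' τ).comp (measurable_snd.prodMk measurable_fst.snd.snd)
  have hsum : Measurable fun p : Event G × (Fin n → Event G) =>
      ∑ σ', (if Rel (p.1.1 : Sym2 V) p.1.2.1 σ σ' then (1 : ENNReal) else 0) *
        evolution b n p.2 p.1.2.2 σ' τ :=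
    Finset.measurable_sum _ fun σ' _ =>
      ((measurable_rel σ σ').comp measurable_fst).mul (hev σ')
  have hF : Measurable fun p : Event G × (Fin n → Event G) =>
      if p.1.2.2 < t then ENNReal.ofReal (Real.exp ((t - p.1.2.2) * b σ)) *
        ∑ σ', (if Rel (p.1.1 : Sym2 V) p.1.2.1 σ σ' then (1 : ENNReal) else 0) *
          evolution b n p.2 p.1.2.2 σ' τ else 0 :=
    Measurable.ite (measurableSet_lt (by fun_prop) measurable_const)
      (Measurable.mul (by fun_prop) hsum) measurable_const
  simp only [evolution]
  rw [lintegral_finsetSum']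
  swap
  · intro i _
    exact (hF.comp (MeasurableEquiv.piFinSuccAbove (fun _ => Event G) i).measurable).aemeasurable
  have hi : ∀ i : Fin (n + 1), ∫⁻ ω : Fin (n + 1) → Event G, (if (ω i).2.2 < t then
      ENNReal.ofReal (Real.exp ((t - (ω i).2.2) * b σ)) *
        ∑ σ', (if Rel (ω i).1 (ω i).2.1 σ σ' then 1 else 0) *
          evolution b n (i.removeNth ω) (ω i).2.2 σ' τ
      else 0) ∂(Measure.pi fun _ => intensity G u β) =
      ∫⁻ x, (if x.2.2 < t then ENNReal.ofReal (Real.exp ((t - x.2.2) * b σ)) *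
        ∑ σ', (if Rel (x.1 : Sym2 V) x.2.1 σ σ' then 1 else 0) *
          ∫⁻ ω, evolution b n ω x.2.2 σ' τ ∂(Measure.pi fun _ => intensity G u β)
        else 0) ∂(intensity G u β) := by
    intro i
    have hmp := measurePreserving_piFinSuccAbove (fun _ : Fin (n + 1) => intensity G u β) i
    have := hmp.lintegral_comp hF
    refine Eq.trans ?_ (this.trans ?_)
    · rfl
    rw [lintegral_prod _ hF.aemeasurable]
    refine lintegral_congr fun x => ?_
    split_ifs
    · have hm : ∀ σ', Measurable fun ω : Fin n → Event G => evolution b n ω x.2.2 σ' τ :=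
        fun σ' => (hev σ').comp measurable_prodMk_left
      dsimp only
      rw [lintegral_const_mul' _ _ ENNReal.ofReal_ne_top, lintegral_finsetSum']
      · congr 1
        refine Finset.sum_congr rfl fun σ' _ => ?_
        exact lintegral_const_mul (if Rel (x.1 : Sym2 V) x.2.1 σ σ' then 1 else 0) (hm σ')
      · exact fun σ' _ => ((hm σ').const_mul
          (if Rel (x.1 : Sym2 V) x.2.1 σ σ' then 1 else 0)).aemeasurable
    · simp
  simp only [hi, Finset.sum_const, Finset.card_univ, Fintype.card_fin, nsmul_eq_mul]
  push_cast
  rfl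

theorem setLIntegral_ite_lt {β t : ℝ} (ht : t ∈ Set.Icc 0 β) {f : ℝ → ℝ} (hf : Continuous f)
    (hf0 : ∀ s ∈ Set.Icc 0 t, 0 ≤ f s) {F : ℝ → ENNReal}
    (hF : ∀ s ∈ Set.Ico 0 t, F s = ENNReal.ofReal (f s)) :
    ∫⁻ s in Set.Icc 0 β, (if s < t then F s else 0) =
      ENNReal.ofReal (∫ s in (0 : ℝ)..t, f s) := by
  have h1 : (fun s => if s < t then F s else 0) = (Set.Iio t).indicator F := by
    funext s
    simp [Set.indicator_apply]
  have h2 : Set.Iio t ∩ Set.Icc 0 β = Set.Ico 0 t := by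
    ext s
    simp only [Set.mem_inter_iff, Set.mem_Iio, Set.mem_Icc, Set.mem_Ico]
    exact ⟨fun h => ⟨h.2.1, h.1⟩, fun h => ⟨h.2, h.1, h.2.le.trans ht.2⟩⟩
  rw [h1, lintegral_indicator measurableSet_Iio, Measure.restrict_restrict measurableSet_Iio, h2,
    setLIntegral_congr_fun measurableSet_Ico hF, intervalIntegral.integral_of_le ht.1,
    ofReal_integral_eq_lintegral_ofReal
      ((hf.integrableOn_Icc (a := 0) (b := t)).mono_set Set.Ioc_subset_Icc_self)
      ((ae_restrict_iff' measurableSet_Ioc).2 (Filter.Eventually.of_forall fun s hs =>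
        hf0 s (Set.Ioc_subset_Icc_self hs)))]
  -- The strict inequality on times gives a half-open interval open at `t`, while the interval
  -- integral uses the one closed at `t`; they differ by a null set.
  exact setLIntegral_congr Ico_ae_eq_Ioc

/-- The factorial counts the orderings of the enumerated points: each induction step multiplies by n
+ 1 for the choice of the latest one. The intensity, summed over edges and kinds, reproduces the
entries of `hopping`. -/
theorem lintegral_evolution [DecidableRel G.Adj] (b : Config V S → ℝ) {u β : ℝ}
    (hu : u ∈ Set.Icc (0 : ℝ) 1) (n : ℕ) {t : ℝ} (ht : t ∈ Set.Icc 0 β) (σ τ : Config V S) :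
    ∫⁻ ω, evolution b n ω t σ τ ∂(Measure.pi fun _ => intensity G u β) =
      ENNReal.ofReal (n.factorial * dyson b (hopping G S u) n t σ τ) := by
  classical
  induction n generalizing t σ τ with
  | zero =>
    simp only [evolution, dyson, lintegral_const, Measure.pi_univ, Finset.univ_eq_empty,
      Finset.prod_empty, mul_one, Nat.factorial_zero, Nat.cast_one, one_mul]
    split_ifs <;> simp
  | succ n ih =>
    rw [lintegral_evolution_succ, lintegral_intensity]
    swap
    · refine Measurable.ite (measurableSet_lt (by fun_prop) measurable_const)
        (Measurable.mul (by fun_prop) (Finset.measurable_sum _ fun σ' _ => ?_)) measurable_const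
      refine (measurable_rel σ σ').mul ?_
      exact (Measurable.lintegral_prod_left' (measurable_evolution b n σ' τ)).comp
        (measurable_snd.snd)
    have hd := continuous_dyson b (hopping G S u) n
    have hd0 : ∀ s ∈ Set.Icc 0 t, ∀ σ', 0 ≤ dyson b (hopping G S u) n s σ' τ :=
      fun s hs σ' => dyson_nonneg (hopping_nonneg G hu) n hs.1 σ' τ
    let r : Sym2 V → Kind → Config V S → ℝ := fun e k σ' => if Rel e k σ σ' then 1 else 0
    have hr0 : ∀ e k σ', 0 ≤ r e k σ' := fun e k σ' => by
      simp only [r]; split_ifs <;> norm_num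
    let f : Sym2 V → Kind → ℝ → ℝ := fun e k s => Real.exp ((t - s) * b σ) *
      ∑ σ', r e k σ' * dyson b (hopping G S u) n s σ' τ
    have hf : ∀ e k, Continuous (f e k) := fun e k =>
      continuous_mul_sum_mul (by fun_prop) _ fun σ' => hd σ' τ
    have hf0 : ∀ e k, ∀ s ∈ Set.Icc 0 t, 0 ≤ f e k s := fun e k s hs =>
      mul_nonneg (Real.exp_nonneg _)
        (Finset.sum_nonneg fun σ' _ => mul_nonneg (hr0 _ _ _) (hd0 s hs σ'))
    have key : ∀ (e : Sym2 V) (k : Kind), (∫⁻ s in Set.Icc 0 β, (if s < t then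
        ENNReal.ofReal (Real.exp ((t - s) * b σ)) * ∑ σ', (if Rel e k σ σ' then 1 else 0) *
          ∫⁻ ω, evolution b n ω s σ' τ ∂(Measure.pi fun _ => intensity G u β) else 0)) =
        ENNReal.ofReal (n.factorial * ∫ s in (0 : ℝ)..t, f e k s) := by
      intro e k
      rw [← intervalIntegral.integral_const_mul]
      refine setLIntegral_ite_lt ht ((hf e k).const_mul _)
        (fun s hs => mul_nonneg (by positivity) (hf0 e k s hs)) fun s hs => ?_
      have hs' : s ∈ Set.Icc 0 β := ⟨hs.1, hs.2.le.trans ht.2⟩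
      have hs'' : s ∈ Set.Icc 0 t := ⟨hs.1, hs.2.le⟩
      simp only [ih hs', f]
      rw [mul_left_comm, ENNReal.ofReal_mul (Real.exp_nonneg _)]
      congr 1
      rw [Finset.mul_sum, ENNReal.ofReal_sum_of_nonneg fun σ' _ =>
        mul_nonneg (Nat.cast_nonneg _) (mul_nonneg (hr0 _ _ _) (hd0 s hs'' σ'))]
      refine Finset.sum_congr rfl fun σ' _ => ?_
      simp only [r]
      split_ifs <;> simp
    simp only [key]
    have hJ0 : ∀ e k, 0 ≤ ∫ s in (0 : ℝ)..t, f e k s := fun e k =>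
      intervalIntegral.integral_nonneg ht.1 (hf0 e k)
    have hdy : dyson b (hopping G S u) (n + 1) t σ τ = ∑ e : G.edgeSet,
        (u * (∫ s in (0 : ℝ)..t, f e Kind.cross s) +
          (1 - u) * ∫ s in (0 : ℝ)..t, f e Kind.bar s) := by
      have hi : ∀ e k, IntervalIntegrable (f e k) volume 0 t :=
        fun e k => (hf e k).intervalIntegrable _ _
      simp only [← intervalIntegral.integral_const_mul]
      rw [Finset.sum_congr rfl fun (e : G.edgeSet) _ => (intervalIntegral.integral_add
          ((hi e Kind.cross).const_mul u) ((hi e Kind.bar).const_mul (1 - u))).symm,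
        ← intervalIntegral.integral_finsetSum fun (e : G.edgeSet) _ =>
          ((hi e Kind.cross).const_mul u).add ((hi e Kind.bar).const_mul (1 - u))]
      simp only [dyson]
      congr 1
      funext s
      have hK : ∀ σ', hopping G S u σ σ' =
          ∑ e : G.edgeSet, (u * r e Kind.cross σ' + (1 - u) * r e Kind.bar σ') := fun σ' =>
        (Finset.sum_subtype G.edgeFinset (fun e => SimpleGraph.mem_edgeFinset)
          fun e => u * r e Kind.cross σ' + (1 - u) * r e Kind.bar σ').trans rfl
      simp only [hK, f, Finset.mul_sum, Finset.sum_mul]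
      rw [Finset.sum_comm]
      refine Finset.sum_congr rfl fun e _ => ?_
      rw [← Finset.sum_add_distrib]
      refine Finset.sum_congr rfl fun σ' _ => ?_
      ring
    have hterm : ∀ e : Sym2 V,
        ENNReal.ofReal u * ENNReal.ofReal (n.factorial * ∫ s in (0 : ℝ)..t, f e Kind.cross s) +
          ENNReal.ofReal (1 - u) *
            ENNReal.ofReal (n.factorial * ∫ s in (0 : ℝ)..t, f e Kind.bar s) =
        ENNReal.ofReal (n.factorial * (u * (∫ s in (0 : ℝ)..t, f e Kind.cross s) +
          (1 - u) * ∫ s in (0 : ℝ)..t, f e Kind.bar s)) := by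
      intro e
      have h1 := hJ0 e Kind.cross
      have h2 := hJ0 e Kind.bar
      have hu0 := hu.1
      have hu1 : 0 ≤ 1 - u := sub_nonneg.2 hu.2
      rw [← ENNReal.ofReal_mul hu0, ← ENNReal.ofReal_mul hu1,
        ← ENNReal.ofReal_add (by positivity) (by positivity)]
      congr 1
      ring
    have hterm0 : ∀ e : Sym2 V, 0 ≤ n.factorial * (u * (∫ s in (0 : ℝ)..t, f e Kind.cross s) +
          (1 - u) * ∫ s in (0 : ℝ)..t, f e Kind.bar s) := fun e =>
      mul_nonneg (Nat.cast_nonneg _) (add_nonneg (mul_nonneg hu.1 (hJ0 _ _))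
        (mul_nonneg (sub_nonneg.2 hu.2) (hJ0 _ _)))
    rw [hdy, Finset.sum_congr rfl fun (e : G.edgeSet) _ => hterm e,
      ← ENNReal.ofReal_sum_of_nonneg fun (e : G.edgeSet) _ => hterm0 e, ← Finset.mul_sum,
      show ((n : ENNReal) + 1) = ENNReal.ofReal (n + 1 : ℕ) by
        rw [ENNReal.ofReal_natCast]; push_cast; rfl,
      ← ENNReal.ofReal_mul (Nat.cast_nonneg _), Nat.factorial_succ]
    push_cast
    congr 1
    ring

end TimeOrdered

/-! ### Time slices -/

section Slices

variable {n : ℕ}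

/-- The number of the times `t` before `s`, that is, the index of the time slice of `s`. -/
def slice (t : Fin n → ℝ) (s : ℝ) : Fin (n + 1) :=
  ⟨(Finset.univ.filter fun i => t i < s).card,
    Nat.lt_succ_of_le ((Finset.card_le_univ _).trans_eq (Fintype.card_fin n))⟩

/-- The position of the `i`-th time in the increasing order. -/
def rank (t : Fin n → ℝ) (i : Fin n) : Fin n :=
  ⟨(Finset.univ.filter fun j => t j < t i).card, by
    refine (Finset.card_lt_card (t := Finset.univ) ?_).trans_eq (by simp)
    exact Finset.filter_ssubset.2 ⟨i, Finset.mem_univ _, lt_irrefl _⟩⟩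

/-- Sets of times below a threshold are nested, so comparing their cardinalities is comparing
thresholds, except that thresholds with no time in between are identified; here `t i` itself
separates them. -/
theorem rank_lt_slice {t : Fin n → ℝ} {i : Fin n} {s : ℝ} :
    (rank t i : ℕ) < slice t s ↔ t i < s := by
  change (Finset.univ.filter fun j => t j < t i).card <
    (Finset.univ.filter fun j => t j < s).card ↔ _
  constructor
  · intro h
    by_contra! hs
    refine absurd h (not_lt.2 (Finset.card_le_card fun j hj => ?_))
    simp only [Finset.mem_filter, Finset.mem_univ, true_and] at hj ⊢
    exact hj.trans_le hs
  · intro h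
    refine Finset.card_lt_card ((Finset.ssubset_iff_of_subset fun j hj => ?_).2 ⟨i, ?_, ?_⟩)
    · simp only [Finset.mem_filter, Finset.mem_univ, true_and] at hj ⊢
      exact hj.trans h
    · simpa using h
    · simp

theorem rank_lt_rank {t : Fin n → ℝ} {i j : Fin n} : rank t i < rank t j ↔ t i < t j :=
  rank_lt_slice (s := t j)

theorem rank_injective {t : Fin n → ℝ} (ht : Function.Injective t) :
    Function.Injective (rank t) := by
  intro i j hij
  refine ht (le_antisymm (not_lt.1 fun h => ?_) (not_lt.1 fun h => ?_))
  · exact (rank_lt_rank.2 h).ne' hij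
  · exact (rank_lt_rank.2 h).ne hij

theorem rank_surjective {t : Fin n → ℝ} (ht : Function.Injective t) :
    Function.Surjective (rank t) :=
  Finite.surjective_of_injective (rank_injective ht)

theorem slice_mono {t : Fin n → ℝ} {s s' : ℝ} (h : s ≤ s') : slice t s ≤ slice t s' := by
  change (Finset.univ.filter fun j => t j < s).card ≤ (Finset.univ.filter fun j => t j < s').card
  refine Finset.card_le_card fun i hi => ?_
  simp only [Finset.mem_filter, Finset.mem_univ, true_and] at hi ⊢
  exact hi.trans_le h

theorem slice_of_forall_le {t : Fin n → ℝ} {s : ℝ} (h : ∀ i, s ≤ t i) : slice t s = 0 := by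
  ext
  simpa [slice, Finset.filter_eq_empty_iff] using h

theorem slice_of_forall_lt {t : Fin n → ℝ} {s : ℝ} (h : ∀ i, t i < s) :
    slice t s = Fin.last n := by
  ext
  simp [slice, Finset.filter_true_of_mem fun i _ => h i]

theorem measurable_comp_slice {E : Type*} [MeasurableSpace E] (t : Fin n → ℝ)
    (f : Fin (n + 1) → E) : Measurable fun s => f (slice t s) := by
  have h : Measurable fun s => (slice t s : ℕ) := by
    simp only [slice, Finset.card_filter]
    exact Finset.measurable_sum _ fun i _ =>
      Measurable.ite (measurableSet_lt measurable_const measurable_id) measurable_const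
        measurable_const
  have := (measurable_of_countable fun k : ℕ => f (Fin.ofNat (n + 1) k)).comp h
  convert! this using 1
  funext s
  simp

theorem intervalIntegrable_comp_slice (t : Fin n → ℝ) (f : Fin (n + 1) → ℝ) (a b : ℝ) :
    IntervalIntegrable (fun s => f (slice t s)) volume a b := by
  obtain ⟨C, hC⟩ := (Set.finite_range fun k => ‖f k‖).bddAbove
  refine (intervalIntegrable_const (c := C)).mono_fun
    (measurable_comp_slice t f).aestronglyMeasurable (Filter.Eventually.of_forall fun s => ?_)
  exact (hC ⟨_, rfl⟩).trans (le_abs_self C)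

variable {t : Fin (n + 1) → ℝ} {i : Fin (n + 1)}

theorem slice_removeNth_of_le {s : ℝ} (hs : s ≤ t i) :
    slice t s = (slice (i.removeNth t) s).castSucc := by
  ext
  simp only [slice, Fin.val_castSucc, Finset.card_filter, Fin.sum_univ_succAbove _ i,
    if_neg hs.not_gt, zero_add]
  rfl

theorem rank_self_of_max (hi : ∀ j, t (i.succAbove j) < t i) : rank t i = Fin.last n := by
  ext
  simp [rank, Finset.card_filter, Fin.sum_univ_succAbove _ i, hi]

theorem rank_succAbove_of_max (hi : ∀ j, t (i.succAbove j) < t i) (j : Fin n) :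
    rank t (i.succAbove j) = (rank (i.removeNth t) j).castSucc := by
  ext
  simp only [rank, Fin.val_castSucc, Finset.card_filter, Fin.sum_univ_succAbove _ i,
    if_neg (hi j).not_gt, zero_add]
  rfl

/-- The latest time `t i` splits the interval: before it the slices are those of the remaining
times, after it there is one last slice, carrying `x`. -/
theorem integral_slice_snoc {α : Type*} (f : α → ℝ) (c : Fin (n + 1) → α) (x : α) (T : ℝ)
    (hi : ∀ j, t (i.succAbove j) < t i) (h0 : 0 ≤ t i) (hT : t i < T) :
    ∫ s in (0 : ℝ)..T, f ((Fin.snoc c x : Fin (n + 2) → α) (slice t s)) =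
      (∫ s in (0 : ℝ)..t i, f (c (slice (i.removeNth t) s))) + (T - t i) * f x := by
  have hint := intervalIntegrable_comp_slice t
    fun k => f ((Fin.snoc c x : Fin (n + 2) → α) k)
  rw [← intervalIntegral.integral_add_adjacent_intervals (hint 0 (t i)) (hint (t i) T)]
  congr 1
  · refine intervalIntegral.integral_congr fun s hs => ?_
    rw [Set.uIcc_of_le h0] at hs
    simp only [slice_removeNth_of_le hs.2, Fin.snoc_castSucc]
  · rw [intervalIntegral.integral_of_le hT.le,
      setIntegral_congr_fun (g := fun _ => f x) measurableSet_Ioc]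
    · simp [hT.le]
    · intro s hs
      have : slice t s = Fin.last (n + 1) := slice_of_forall_lt fun j => by
        rcases Fin.eq_self_or_eq_succAbove i j with rfl | ⟨k, rfl⟩
        · exact hs.1
        · exact (hi k).trans hs.1
      simp only [this, Fin.snoc_last]

end Slices

/-! ### Expansion of the time-ordered product over space-time configurations -/

section Paths

variable {V : Type*} [Fintype V] [DecidableEq V] {S : ℕ} {G : SimpleGraph V}

/-- The times of the transitions. -/
def times {n : ℕ} (ω : Fin n → Event G) (i : Fin n) : ℝ := (ω i).2.2

/-- The configurations in the successive time slices are allowed by the transitions. -/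
def Compatible {n : ℕ} (ω : Fin n → Event G) (c : Fin (n + 1) → Config V S) : Prop :=
  ∀ i, Rel (ω i).1 (ω i).2.1 (c (rank (times ω) i).succ) (c (rank (times ω) i).castSucc)

/-- Chosen times must decrease strictly from `t`, so a transition at or after `t` can never be used.
-/
theorem evolution_eq_zero (b : Config V S → ℝ) {n : ℕ} {ω : Fin n → Event G} {t : ℝ}
    (j : Fin n) (hj : t ≤ times ω j) (σ τ : Config V S) : evolution b n ω t σ τ = 0 := by
  induction n generalizing t σ with
  | zero => exact j.elim0
  | succ n ih =>
    simp only [evolution]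
    refine Finset.sum_eq_zero fun i _ => ?_
    split_ifs with hi
    swap
    · rfl
    rcases Fin.eq_self_or_eq_succAbove i j with rfl | ⟨k, rfl⟩
    · exact absurd hi hj.not_gt
    · have : ∀ σ', evolution b n (i.removeNth ω) (ω i).2.2 σ' τ = 0 := fun σ' =>
        ih k (hi.le.trans hj) σ'
      simp [this]

-- Inserting intermediate configurations turns the product into a sum over paths. The induction
-- peels off the latest transition together with the top slice.
open Classical in
theorem evolution_eq_sum (b : Config V S → ℝ) {n : ℕ} {ω : Fin n → Event G} {t : ℝ}
    (hinj : Function.Injective (times ω)) (h0 : ∀ i, 0 ≤ times ω i) (ht : ∀ i, times ω i < t)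
    (σ τ : Config V S) :
    evolution b n ω t σ τ = ∑ c : Fin (n + 1) → Config V S,
      if c 0 = τ ∧ c (Fin.last n) = σ ∧ Compatible ω c then
        ENNReal.ofReal (Real.exp (∫ s in (0 : ℝ)..t, b (c (slice (times ω) s)))) else 0 := by
  induction n generalizing t σ with
  | zero =>
    rw [← (Equiv.funUnique (Fin 1) (Config V S)).symm.sum_comp]
    simp only [evolution, Compatible]
    rw [Finset.sum_eq_single σ]
    · simp [eq_comm]
    · intro x _ hx
      simp [hx]
    · simp
  | succ n ih =>
    -- Only the latest transition can be outermost: any other choice leaves a later one in the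
    -- remaining product, which then vanishes.
    obtain ⟨i, hi⟩ := Finite.exists_max (times ω)
    have hi' : ∀ j, times ω (i.succAbove j) < times ω i := fun j =>
      lt_of_le_of_ne (hi _) (hinj.ne (Fin.succAbove_ne i j))
    simp only [evolution]
    rw [Finset.sum_eq_single i]
    rotate_left
    · intro j _ hj
      obtain ⟨k, hk⟩ := Fin.exists_succAbove_eq hj.symm
      have : ∀ σ', evolution b n (j.removeNth ω) (ω j).2.2 σ' τ = 0 := fun σ' =>
        evolution_eq_zero b k (by
          change (ω j).2.2 ≤ times ω (j.succAbove k)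
          rw [hk]
          exact hi j) σ' τ
      simp [this]
    · simp
    rw [if_pos (show (ω i).2.2 < t from ht i), ← (Fin.snocEquiv fun _ => Config V S).sum_comp, Fintype.sum_prod_type]
    have hinj' : Function.Injective (times (i.removeNth ω)) :=
      hinj.comp Fin.succAbove_right_injective
    have hih := fun σ' => ih (t := (ω i).2.2) hinj' (fun j => h0 _) (fun j => hi' j) σ'
    simp only [hih]
    have hcomp : ∀ (c : Fin (n + 1) → Config V S) (x : Config V S),
        Compatible ω (Fin.snoc c x : Fin (n + 2) → Config V S) ↔
          Rel (ω i).1 (ω i).2.1 x (c (Fin.last n)) ∧ Compatible (i.removeNth ω) c := by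
      intro c x
      have hr : i.removeNth (times ω) = times (i.removeNth ω) := rfl
      simp only [Compatible, Fin.forall_iff_succAbove i, rank_self_of_max hi',
        rank_succAbove_of_max hi', Fin.succ_last, Fin.snoc_last, Fin.snoc_castSucc,
        Fin.succ_castSucc, hr]
      rfl
    have hsn : ∀ (c : Fin (n + 1) → Config V S) (x : Config V S),
        Fin.snocEquiv (fun _ => Config V S) (x, c) = Fin.snoc c x := fun _ _ => rfl
    have h00 : ∀ (c : Fin (n + 1) → Config V S) (x : Config V S),
        (Fin.snoc c x : Fin (n + 2) → Config V S) 0 = c 0 := fun c x =>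
      Fin.snoc_castSucc (α := fun _ => Config V S) x c 0
    simp only [hsn, h00, Fin.snoc_last, hcomp,
      integral_slice_snoc b _ _ t hi' (h0 i) (ht i)]
    refine Eq.trans ?_ (Finset.sum_eq_single σ (fun x _ hx => by simp [hx]) (by simp)).symm
    simp only [Finset.mul_sum]
    rw [Finset.sum_comm]
    refine Finset.sum_congr rfl fun c _ => ?_
    -- The intermediate configuration σ' must be the one of the top slice below the transition.
    rw [Finset.sum_eq_single (c (Fin.last n))]
    rotate_left
    · intro x _ hx
      rw [if_neg fun h : c 0 = τ ∧ c (Fin.last n) = x ∧ Compatible (i.removeNth ω) c =>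
        hx h.2.1.symm, mul_zero, mul_zero]
    · simp
    by_cases h1 : Rel (ω i).1 (ω i).2.1 σ (c (Fin.last n)) <;>
      by_cases h2 : c 0 = τ <;> by_cases h3 : Compatible (i.removeNth ω) c <;>
      simp only [h1, h2, h3, and_true, and_false, if_true, if_false, mul_zero,
        zero_mul, one_mul]
    rw [← ENNReal.ofReal_mul (Real.exp_nonneg _), ← Real.exp_add, add_comm]
    rfl

end Paths

/-! ### Products of two involutions -/

section Involutions

variable {X : Type*} {A B : Equiv.Perm X}

/-- The dihedral relation: a reflection inverts the rotation. -/
theorem semiconjBy_mul_inv (hA : A * A = 1) (hB : B * B = 1) : SemiconjBy A (A * B) (A * B)⁻¹ := by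
  have hA' : A⁻¹ = A := inv_eq_of_mul_eq_one_right hA
  have hB' : B⁻¹ = B := inv_eq_of_mul_eq_one_right hB
  rw [SemiconjBy, mul_inv_rev, hA', hB', ← mul_assoc, hA, one_mul, mul_assoc, hA, mul_one]

theorem zpow_mul_apply_involution (hA : A * A = 1) (hB : B * B = 1) (k : ℤ) (z : X) :
    A (((A * B) ^ k) z) = ((A * B) ^ (-k)) (A z) := by
  have h := (semiconjBy_mul_inv hA hB).zpow_right k
  rw [zpow_neg, ← inv_zpow]
  exact congrArg (fun f : Equiv.Perm X => f z) h.eq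

theorem sameCycle_involution (hA : A * A = 1) (hB : B * B = 1) {z w : X}
    (h : (A * B).SameCycle z w) : (A * B).SameCycle (A z) (A w) := by
  obtain ⟨k, rfl⟩ := h
  exact ⟨-k, (zpow_mul_apply_involution hA hB k z).symm⟩

/-- If `A` and `B` are involutions without fixed points, then `z` and `A z` lie in distinct cycles
of `A * B`. -/
theorem not_sameCycle_involution (hA : A * A = 1) (hB : B * B = 1) (hA' : ∀ z, A z ≠ z)
    (hB' : ∀ z, B z ≠ z) (z : X) : ¬ (A * B).SameCycle z (A z) := by
  rintro ⟨k, hk⟩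
  -- With w = (AB)^j z, the relation (AB)^k z = A z becomes w = A w for k = 2j, and A B w = A w,
  -- hence B w = w, for k = 2j + 1.
  obtain ⟨j, rfl | rfl⟩ := Int.even_or_odd' k
  · rw [two_mul, zpow_add, Equiv.Perm.mul_apply, ← Equiv.Perm.eq_inv_iff_eq, ← zpow_neg,
      ← zpow_mul_apply_involution hA hB] at hk
    exact hA' _ hk.symm
  · rw [show 2 * j + 1 = j + (1 + j) by ring, zpow_add, Equiv.Perm.mul_apply,
      ← Equiv.Perm.eq_inv_iff_eq, ← zpow_neg, ← zpow_mul_apply_involution hA hB, zpow_add,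
      zpow_one, Equiv.Perm.mul_apply, Equiv.Perm.mul_apply] at hk
    exact hB' _ (A.injective hk)

end Involutions

/-! ### Loops through the time slices -/

section Ends

variable {V : Type*} [Fintype V] [DecidableEq V]

theorem edgeSwap_edgeSwap (e : Sym2 V) (x : V) : edgeSwap e (edgeSwap e x) = x := by
  induction e using Sym2.ind with
  | _ a b => simp

theorem edgeSwap_of_notMem {e : Sym2 V} {x : V} (hx : x ∉ e) : edgeSwap e x = x := by
  induction e using Sym2.ind with
  | _ a b =>
    rw [Sym2.mem_iff, not_or] at hx
    exact Equiv.swap_apply_of_ne_of_ne hx.1 hx.2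

theorem eq_mk_edgeSwap {e : Sym2 V} {x : V} (hx : x ∈ e) : e = s(x, edgeSwap e x) := by
  induction e using Sym2.ind with
  | _ a b =>
    rw [Sym2.mem_iff] at hx
    rcases hx with rfl | rfl <;> simp [Sym2.eq_swap]

theorem edgeSwap_mem {e : Sym2 V} {x : V} (hx : x ∈ e) : edgeSwap e x ∈ e := by
  have h := Sym2.mem_mk_right x (edgeSwap e x)
  rwa [← eq_mk_edgeSwap hx] at h

theorem edgeSwap_ne {e : Sym2 V} (he : ¬ e.IsDiag) {x : V} (hx : x ∈ e) : edgeSwap e x ≠ x := by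
  intro h
  have := eq_mk_edgeSwap hx
  rw [h] at this
  exact he (this ▸ rfl)

open Classical in
/-- The junctions made by a transition (or by none) between the vertical lines below it
(second component `true`) and above it (second component `false`). -/
def joint : Option (Sym2 V × Kind) → V × Bool → V × Bool
  | none, r => (r.1, !r.2)
  | some (e, Kind.cross), r => (edgeSwap e r.1, !r.2)
  | some (e, Kind.bar), r => if r.1 ∈ e then (edgeSwap e r.1, r.2) else (r.1, !r.2)

theorem joint_joint (o : Option (Sym2 V × Kind)) (r : V × Bool) : joint o (joint o r) = r := by
  match o with
  | none => simp [joint]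
  | some (e, Kind.cross) => simp [joint, edgeSwap_edgeSwap]
  | some (e, Kind.bar) =>
    by_cases h : r.1 ∈ e
    · simp [joint, h, edgeSwap_edgeSwap, edgeSwap_mem h]
    · simp [joint, h]

theorem joint_ne {o : Option (Sym2 V × Kind)} (ho : ∀ e k, o = some (e, k) → ¬ e.IsDiag)
    (r : V × Bool) : joint o r ≠ r := by
  intro h
  match o with
  | none => simpa [joint] using congrArg Prod.snd h
  | some (e, Kind.cross) => simpa [joint] using congrArg Prod.snd h
  | some (e, Kind.bar) =>
    by_cases hr : r.1 ∈ e
    · exact edgeSwap_ne (ho e _ rfl) hr (by simpa [joint, hr] using congrArg Prod.fst h)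
    · simpa [joint, hr] using congrArg Prod.snd h

theorem joint_of_notMem {o : Option (Sym2 V × Kind)} {x : V}
    (ho : ∀ e k, o = some (e, k) → x ∉ e) (d : Bool) : joint o (x, d) = (x, !d) := by
  match o with
  | none => rfl
  | some (e, Kind.cross) => simp [joint, edgeSwap_of_notMem (ho e _ rfl)]
  | some (e, Kind.bar) => simp [joint, ho e _ rfl]

variable {n : ℕ}

/-- Given a boundary `m` between time slices, `place m (x, true)` is the vertical line of `x` below
it, directed upwards, and `place m (x, false)` is the one above it, directed downwards. -/
def place (m : Fin (n + 1)) (r : V × Bool) : V × Fin (n + 1) × Bool :=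
  (r.1, if r.2 then m else m + 1, r.2)

/-- The continuation of a directed vertical element through the junction at its end, directed
backwards. -/
def turn (B : Fin (n + 1) → Option (Sym2 V × Kind)) (z : V × Fin (n + 1) × Bool) :
    V × Fin (n + 1) × Bool :=
  place (if z.2.2 then z.2.1 else z.2.1 - 1)
    (joint (B (if z.2.2 then z.2.1 else z.2.1 - 1)) (z.1, z.2.2))

theorem place_surjective (z : V × Fin (n + 1) × Bool) :
    z = place (if z.2.2 then z.2.1 else z.2.1 - 1) (z.1, z.2.2) := by
  obtain ⟨x, k, _ | _⟩ := z <;> simp [place]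

theorem place_injective (m : Fin (n + 1)) :
    Function.Injective (place m : V × Bool → V × Fin (n + 1) × Bool) := fun _ _ h =>
  Prod.ext (congrArg (fun z => z.1) h) (congrArg (fun z => z.2.2) h)

theorem turn_place (B : Fin (n + 1) → Option (Sym2 V × Kind)) (m : Fin (n + 1)) (r : V × Bool) :
    turn B (place m r) = place m (joint (B m) r) := by
  obtain ⟨x, _ | _⟩ := r <;> simp [turn, place]

/-- The reversal of the direction of vertical elements. -/
def reverse : Equiv.Perm (V × Fin (n + 1) × Bool) :=
  Function.Involutive.toPerm (fun z => (z.1, z.2.1, !z.2.2)) fun z => by simp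

@[simp] theorem reverse_apply (x : V) (k : Fin (n + 1)) (d : Bool) :
    reverse (x, k, d) = (x, k, !d) := rfl

theorem reverse_reverse (z : V × Fin (n + 1) × Bool) : reverse (reverse z) = z := by
  obtain ⟨x, k, d⟩ := z
  simp

theorem turn_turn (B : Fin (n + 1) → Option (Sym2 V × Kind)) (z : V × Fin (n + 1) × Bool) :
    turn B (turn B z) = z := by
  rw [place_surjective z, turn_place, turn_place, joint_joint]

/-- `turn` as a permutation. -/
def turnPerm (B : Fin (n + 1) → Option (Sym2 V × Kind)) : Equiv.Perm (V × Fin (n + 1) × Bool) :=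
  Function.Involutive.toPerm (turn B) (turn_turn B)

@[simp] theorem turnPerm_apply (B : Fin (n + 1) → Option (Sym2 V × Kind))
    (z : V × Fin (n + 1) × Bool) : turnPerm B z = turn B z := rfl

/-- The motion along the oriented loops, from one vertical element to the next one. -/
def follow (B : Fin (n + 1) → Option (Sym2 V × Kind)) : Equiv.Perm (V × Fin (n + 1) × Bool) :=
  reverse * turnPerm B

theorem reverse_mul_self :
    (reverse * reverse : Equiv.Perm (V × Fin (n + 1) × Bool)) = 1 := by
  ext z : 1
  obtain ⟨x, k, d⟩ := z
  simp

theorem turnPerm_mul_self (B : Fin (n + 1) → Option (Sym2 V × Kind)) :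
    turnPerm B * turnPerm B = 1 := by
  ext z : 1
  simp [turn_turn]

theorem sameCycle_reverse (B : Fin (n + 1) → Option (Sym2 V × Kind))
    {z w : V × Fin (n + 1) × Bool} (h : (follow B).SameCycle z w) :
    (follow B).SameCycle (reverse z) (reverse w) :=
  sameCycle_involution reverse_mul_self (turnPerm_mul_self B) h

/-- Edges that are not diagonal make every junction join two different ends, so `turnPerm` has no
fixed point. -/
theorem not_sameCycle_reverse {B : Fin (n + 1) → Option (Sym2 V × Kind)}
    (hB : ∀ m e k, B m = some (e, k) → ¬ e.IsDiag) (z : V × Fin (n + 1) × Bool) :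
    ¬ (follow B).SameCycle z (reverse z) := by
  refine not_sameCycle_involution reverse_mul_self (turnPerm_mul_self B) (fun z => ?_)
    (fun z => ?_) z
  · obtain ⟨x, k, d⟩ := z
    simp
  · rw [turnPerm_apply, place_surjective z, turn_place]
    exact fun h => joint_ne (hB _) _ (place_injective _ h)

theorem sameCycle_turn (B : Fin (n + 1) → Option (Sym2 V × Kind)) (z : V × Fin (n + 1) × Bool) :
    (follow B).SameCycle z (reverse (turn B z)) :=
  ⟨1, by simp [follow]⟩

/-- Vertical elements at a site that is not touched by the transitions in between belong to the
same oriented loop. -/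
theorem sameCycle_vertical {B : Fin (n + 1) → Option (Sym2 V × Kind)} {x : V}
    {k k' : Fin (n + 1)} (hk : k ≤ k')
    (h : ∀ m, k ≤ m → m < k' → ∀ e κ, B m = some (e, κ) → x ∉ e) (d : Bool) :
    (follow B).SameCycle (x, k, d) (x, k', d) := by
  have key : (follow B).SameCycle (x, k, true) (x, k', true) := by
    induction k' using Fin.induction with
    | zero => rw [Fin.le_zero_iff.1 hk]
    | succ i ih =>
      rcases hk.lt_or_eq with hlt | rfl
      · have hki : k ≤ i.castSucc := Fin.le_castSucc_iff.2 hlt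
        refine (ih hki fun m hm hm' => h m hm (hm'.trans Fin.castSucc_lt_succ)).trans ?_
        have := sameCycle_turn B (place i.castSucc (x, true))
        rw [turn_place, joint_of_notMem (h _ hki Fin.castSucc_lt_succ)] at this
        simpa [place, Fin.coeSucc_eq_succ] using this
      · rfl
  cases d
  · exact sameCycle_reverse B key
  · exact key

end Ends

/-! ### From loops of space-time points to cycles of vertical elements -/

section Loops

variable {V : Type*} [Fintype V] [DecidableEq V] {S : ℕ} {G : SimpleGraph V} {β : ℝ}
  {ω : Realization G}

/-- The transitions occur at distinct times in `(0, β)`. -/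
def Regular (β : ℝ) (ω : Realization G) : Prop :=
  Function.Injective (times ω.2) ∧ ∀ i, times ω.2 i ∈ Set.Ioo 0 β

open Classical in
/-- The transition at each boundary between time slices. The last boundary joins the times `β` and
`0`, without transition. -/
def boundary (ω : Realization G) (m : Fin (ω.1 + 1)) : Option (Sym2 V × Kind) :=
  if h : ∃ i, (rank (times ω.2) i).castSucc = m then
    some ((ω.2 h.choose).1, (ω.2 h.choose).2.1) else none

theorem boundary_eq_some {m : Fin (ω.1 + 1)} {e : Sym2 V} {k : Kind}
    (h : boundary ω m = some (e, k)) :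
    ∃ i, (rank (times ω.2) i).castSucc = m ∧ ((ω.2 i).1 : Sym2 V) = e ∧ (ω.2 i).2.1 = k := by
  unfold boundary at h
  split_ifs at h with hm
  simp only [Option.some.injEq, Prod.mk.injEq] at h
  exact ⟨hm.choose, hm.choose_spec, h.1, h.2⟩

theorem boundary_rank (hω : Regular β ω) (i : Fin ω.1) :
    boundary ω (rank (times ω.2) i).castSucc = some (((ω.2 i).1 : Sym2 V), (ω.2 i).2.1) := by
  have h : ∃ j, (rank (times ω.2) j).castSucc = (rank (times ω.2) i).castSucc := ⟨i, rfl⟩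
  have hj : h.choose = i := rank_injective hω.1 (Fin.castSucc_injective _ h.choose_spec)
  rw [boundary, dif_pos h, hj]

theorem boundary_last : boundary ω (Fin.last ω.1) = none := by
  rw [boundary, dif_neg]
  rintro ⟨i, hi⟩
  exact Fin.castSucc_ne_last _ hi

theorem boundary_not_isDiag {m : Fin (ω.1 + 1)} {e : Sym2 V} {k : Kind}
    (h : boundary ω m = some (e, k)) : ¬ e.IsDiag := by
  obtain ⟨i, -, rfl, -⟩ := boundary_eq_some h
  exact G.not_isDiag_of_mem_edgeSet (ω.2 i).1.2

/-- The directed vertical element that contains a space-time point. -/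
def code (z : Point β ω × Bool) : V × Fin (ω.1 + 1) × Bool :=
  (z.1.1.1, slice (times ω.2) z.1.1.2, z.2)

/-- A transition between the two slices has its time in `I`, hence does not touch `x`. -/
theorem sameCycle_of_clear {x : V} {k k' : Fin (ω.1 + 1)} (hk : k ≤ k')
    {I : Set ℝ} (hI : Clear ω x I)
    (h : ∀ i, k ≤ (rank (times ω.2) i).castSucc → (rank (times ω.2) i).castSucc < k' →
      times ω.2 i ∈ I) (d : Bool) :
    (follow (boundary ω)).SameCycle (x, k, d) (x, k', d) := by
  refine sameCycle_vertical hk (fun m hm hm' e κ he hx => ?_) d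
  obtain ⟨i, rfl, rfl, -⟩ := boundary_eq_some he
  exact hI i hx (h i hm hm')

theorem castSucc_rank_lt_slice {i : Fin ω.1} {s : ℝ} :
    (rank (times ω.2) i).castSucc < slice (times ω.2) s ↔ times ω.2 i < s :=
  rank_lt_slice

theorem slice_le_castSucc_rank {i : Fin ω.1} {s : ℝ} :
    slice (times ω.2) s ≤ (rank (times ω.2) i).castSucc ↔ s ≤ times ω.2 i := by
  rw [← not_lt, castSucc_rank_lt_slice, not_lt]

theorem sameCycle_of_clear_Ico {x : V} {s s' : ℝ} (h : s ≤ s')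
    (hc : Clear ω x (Set.Ico s s')) (d : Bool) :
    (follow (boundary ω)).SameCycle (x, slice (times ω.2) s, d) (x, slice (times ω.2) s', d) :=
  sameCycle_of_clear (slice_mono h) hc (fun _ hi hi' =>
    ⟨slice_le_castSucc_rank.1 hi, castSucc_rank_lt_slice.1 hi'⟩) d

theorem sameCycle_of_clear_Ioc {x : V} {i : Fin ω.1} {s : ℝ}
    (h : times ω.2 i < s) (hc : Clear ω x (Set.Ioc (times ω.2 i) s)) (d : Bool) :
    (follow (boundary ω)).SameCycle (x, (rank (times ω.2) i).succ, d)
      (x, slice (times ω.2) s, d) := by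
  refine sameCycle_of_clear (Fin.castSucc_lt_iff_succ_le.1 ?_) hc (fun j hj hj' => ⟨?_, ?_⟩) d
  · exact castSucc_rank_lt_slice.2 h
  · exact rank_lt_rank.1 (Fin.succ_le_castSucc_iff.1 hj)
  · exact (castSucc_rank_lt_slice.1 hj').le

theorem sameCycle_joint (hω : Regular β ω) (i : Fin ω.1) (r : V × Bool) :
    (follow (boundary ω)).SameCycle (place (rank (times ω.2) i).castSucc r)
      (reverse (place (rank (times ω.2) i).castSucc
        (joint (some (((ω.2 i).1 : Sym2 V), (ω.2 i).2.1)) r))) := by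
  have := sameCycle_turn (boundary ω) (place (rank (times ω.2) i).castSucc r)
  rwa [turn_place, boundary_rank hω] at this

/-- Elementary displacements stay on the same oriented loop of vertical elements. -/
theorem Step.sameCycle (hω : Regular β ω) {z w : Point β ω × Bool} (h : Step β ω z w) :
    (follow (boundary ω)).SameCycle (code z) (code w) := by
  cases h with
  | vertical p q d hx hc =>
    simp only [code, ← hx]
    rcases le_total p.1.2 q.1.2 with hle | hle
    · rw [Set.uIcc_of_le hle] at hc
      exact sameCycle_of_clear_Ico hle
        (fun i hi hi' => hc i hi (Set.Ico_subset_Icc_self hi')) d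
    · rw [Set.uIcc_of_ge hle] at hc
      exact (sameCycle_of_clear_Ico hle
        (fun i hi hi' => hc i hi (Set.Ico_subset_Icc_self hi')) d).symm
  | periodic p q d hx hc hc' =>
    simp only [code, ← hx]
    have h1 := sameCycle_of_clear_Ico p.2.1.2.le
      (fun i hi hi' => hc i hi (Set.Ico_subset_Icc_self hi')) d
    have h2 := sameCycle_of_clear_Ico q.2.1.1.le
      (fun i hi hi' => hc' i hi (Set.Ico_subset_Icc_self hi')) d
    rw [slice_of_forall_lt fun i => (hω.2 i).2] at h1
    rw [slice_of_forall_le fun i => (hω.2 i).1.le] at h2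
    refine h1.trans (Equiv.Perm.SameCycle.trans ?_ h2)
    -- Addition in `Fin` wraps around, so the slice after the last one is slice 0: the last boundary
    -- implements the periodicity in time.
    have h3 := sameCycle_turn (boundary ω) (place (Fin.last ω.1) (p.1.1, true))
    rw [turn_place, boundary_last] at h3
    simp only [place, joint, Fin.last_add_one, reverse_apply, if_true, Bool.not_true,
      Bool.false_eq_true, if_false, Bool.not_false] at h3
    cases d
    · exact sameCycle_reverse _ h3
    · exact h3
  | cross p q d r he hp hq hc hc' =>
    obtain ⟨i, hi, hk, rfl⟩ := he
    have h1 := sameCycle_of_clear_Ico hp.le hc true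
    have h2 := sameCycle_of_clear_Ioc hq hc' true
    have h3 := sameCycle_joint hω i (p.1.1, true)
    simp only [hi, hk, place, joint, edgeSwap_mk, Equiv.swap_apply_left, reverse_apply, if_true,
      Bool.not_true, Bool.false_eq_true, if_false, Bool.not_false, Fin.coeSucc_eq_succ] at h3
    have h := (h1.trans h3).trans h2
    cases d
    · exact sameCycle_reverse _ h
    · exact h
  | barBelow p q d r he hp hq hc hc' =>
    obtain ⟨i, hi, hk, rfl⟩ := he
    have h1 := sameCycle_of_clear_Ico hp.le hc true
    have h2 := sameCycle_of_clear_Ico hq.le hc' false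
    have h3 := sameCycle_joint hω i (p.1.1, true)
    simp only [hi, hk, place, joint, edgeSwap_mk, Equiv.swap_apply_left, reverse_apply, if_true,
      Bool.not_true, Sym2.mem_mk_left] at h3
    have h := (h1.trans h3).trans h2.symm
    cases d
    · exact sameCycle_reverse _ h
    · exact h
  | barAbove p q d r he hp hq hc hc' =>
    obtain ⟨i, hi, hk, rfl⟩ := he
    have h1 := sameCycle_of_clear_Ioc hp hc false
    have h2 := sameCycle_of_clear_Ioc hq hc' true
    have h3 := sameCycle_joint hω i (p.1.1, false)
    simp only [hi, hk, place, joint, edgeSwap_mk, Equiv.swap_apply_left, reverse_apply, if_true,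
      Bool.false_eq_true, if_false, Bool.not_false, Sym2.mem_mk_left, Fin.coeSucc_eq_succ] at h3
    have h := (h1.symm.trans h3).trans h2
    cases d
    · exact h
    · exact sameCycle_reverse _ h

theorem Step.reverse {p q : Point β ω} {d d' : Bool} (h : Step β ω (p, d) (q, d')) :
    Step β ω (p, !d) (q, !d') := by
  cases h with
  | vertical _ _ _ hx hc => exact Step.vertical p q _ hx hc
  | periodic _ _ _ hx hc hc' => exact Step.periodic p q _ hx hc hc'
  | cross _ _ _ r he hp hq hc hc' => exact Step.cross p q _ r he hp hq hc hc'
  | barBelow _ _ _ r he hp hq hc hc' => exact Step.barBelow p q _ r he hp hq hc hc'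
  | barAbove _ _ _ r he hp hq hc hc' => exact Step.barAbove p q _ r he hp hq hc hc'

/-- Equal classes of directed points stay equal when the directions are reversed. -/
theorem OrientedLoop.mk_reverse {p q : Point β ω} {d d' : Bool}
    (h : (Quot.mk _ (p, d) : OrientedLoop β ω) = Quot.mk _ (q, d')) :
    (Quot.mk _ (p, !d) : OrientedLoop β ω) = Quot.mk _ (q, !d') := by
  let f : OrientedLoop β ω → OrientedLoop β ω :=
    Quot.map (fun z => (z.1, !z.2)) fun _ _ h => h.reverse
  exact congrArg f h

theorem OrientedLoop.sameCycle_of_mk_eq (hω : Regular β ω) {z w : Point β ω × Bool}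
    (h : (Quot.mk _ z : OrientedLoop β ω) = Quot.mk _ w) :
    (follow (boundary ω)).SameCycle (code z) (code w) := by
  have := Quot.eqvGen_exact h
  clear h
  induction this with
  | rel _ _ h => exact Step.sameCycle hω h
  | refl _ => exact Equiv.Perm.SameCycle.refl _ _
  | symm _ _ _ ih => exact ih.symm
  | trans _ _ _ _ _ ih ih' => exact ih.trans ih'

/-- Points on one oriented loop have codes in one cycle, and a cycle never contains an element and
its reversal. -/
theorem OrientedLoop.mk_ne_mk_not (hω : Regular β ω) (p : Point β ω) (d : Bool) :
    (Quot.mk _ (p, d) : OrientedLoop β ω) ≠ Quot.mk _ (p, !d) := fun h =>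
  not_sameCycle_reverse (fun _ _ _ h => boundary_not_isDiag h) _
    (OrientedLoop.sameCycle_of_mk_eq hω h)

/-- A loop is made of its points with directions given by an orientation. -/
theorem OrientedLoop.eq_mk_or {γ : OrientedLoop β ω} {p : Point β ω}
    (h : γ.forget = Quot.mk _ p) : γ = Quot.mk _ (p, true) ∨ γ = Quot.mk _ (p, false) := by
  -- An undirected chain of displacements lifts to directed points from either initial direction;
  -- `c` records the parity of the reversals along it.
  have key : ∀ {q q' : Point β ω}, Relation.EqvGen
      (fun p q : Point β ω => ∃ d d' : Bool, Step β ω (p, d) (q, d')) q q' →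
      ∃ c, ∀ b, (Quot.mk _ (q, b) : OrientedLoop β ω) = Quot.mk _ (q', b ^^ c) := by
    intro q q' hqq
    induction hqq with
    | rel q q' h =>
      obtain ⟨d, d', h⟩ := h
      refine ⟨d ^^ d', fun b => ?_⟩
      by_cases hb : b = d
      · subst hb
        simpa using Quot.sound h
      · obtain rfl : b = !d := by cases b <;> cases d <;> simp_all
        simpa using Quot.sound h.reverse
    | refl q => exact ⟨false, fun b => by simp⟩
    | symm q q' _ ih =>
      obtain ⟨c, h⟩ := ih
      exact ⟨c, fun b => by simpa using (h (b ^^ c)).symm⟩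
    | trans q q' q'' _ _ ih ih' =>
      obtain ⟨c, h⟩ := ih
      obtain ⟨c', h'⟩ := ih'
      exact ⟨c ^^ c', fun b => by rw [h, h', Bool.xor_assoc]⟩
  induction γ using Quot.ind with
  | mk z =>
    obtain ⟨q, b⟩ := z
    obtain ⟨c, hc⟩ := key (Quot.eqvGen_exact h)
    rw [hc b]
    cases b ^^ c
    · exact Or.inr rfl
    · exact Or.inl rfl

end Loops

/-! ### Representatives of vertical elements, and spins of loops as coordinates on configurations -/

section Bijection

variable {V : Type*} [Fintype V] [DecidableEq V] {S : ℕ} {G : SimpleGraph V} {β : ℝ}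
  {ω : Realization G}

theorem exists_mem_slice (hω : Regular β ω) (hβ : 0 < β) (k : Fin (ω.1 + 1)) :
    ∃ s ∈ Set.Ioo 0 β, slice (times ω.2) s = k ∧ ∀ i, times ω.2 i ≠ s := by
  classical
  -- The point must exceed 0 and the transitions below slice `k`, and precede `β` and the others;
  -- including 0 and `β` also handles the extreme slices.
  obtain ⟨s, hlo, hhi⟩ := Order.exists_between_finsets
    (lo := insert 0 ((Finset.univ.filter fun i => (rank (times ω.2) i).castSucc < k).image
      (times ω.2)))
    (hi := insert β ((Finset.univ.filter fun i => k ≤ (rank (times ω.2) i).castSucc).image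
      (times ω.2))) (by
        simp only [Finset.forall_mem_insert, Finset.forall_mem_image, Finset.mem_filter,
          Finset.mem_univ, true_and]
        exact ⟨⟨hβ, fun i _ => (hω.2 i).1⟩, fun i hi => ⟨(hω.2 i).2, fun j hj =>
          rank_lt_rank.1 (Fin.castSucc_lt_castSucc_iff.1 (hi.trans_le hj))⟩⟩)
  simp only [Finset.forall_mem_insert, Finset.forall_mem_image, Finset.mem_filter,
    Finset.mem_univ, true_and] at hlo hhi
  have hiff : ∀ i, (rank (times ω.2) i).castSucc < slice (times ω.2) s ↔
      (rank (times ω.2) i).castSucc < k := fun i => by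
    rw [castSucc_rank_lt_slice]
    refine ⟨fun h => ?_, fun h => hlo.2 h⟩
    by_contra! hk
    exact h.not_gt (hhi.2 hk)
  refine ⟨s, ⟨hlo.1, hhi.1⟩, ?_, fun i hi => ?_⟩
  -- If the indices differed, the smaller one would be the rank of some transition, and that
  -- transition would lie below one slice but not the other.
  · rcases lt_trichotomy (slice (times ω.2) s) k with h | h | h
    · obtain ⟨i, hi⟩ := rank_surjective hω.1 ((slice (times ω.2) s).castPred (Fin.ne_last_of_lt h))
      have hi' : (rank (times ω.2) i).castSucc = slice (times ω.2) s := by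
        rw [hi, Fin.castSucc_castPred]
      exact absurd ((hiff i).2 (hi' ▸ h)) (hi' ▸ lt_irrefl _)
    · exact h
    · obtain ⟨i, hi⟩ := rank_surjective hω.1 (k.castPred (Fin.ne_last_of_lt h))
      have hi' : (rank (times ω.2) i).castSucc = k := by
        rw [hi, Fin.castSucc_castPred]
      exact absurd ((hiff i).1 (hi' ▸ h)) (hi' ▸ lt_irrefl _)
  · by_cases h : (rank (times ω.2) i).castSucc < k
    · exact (hlo.2 h).ne hi
    · exact (hhi.2 (not_lt.1 h)).ne' hi

/-- A point in a given vertical element. -/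
def slicePoint (hω : Regular β ω) (hβ : 0 < β) (x : V) (k : Fin (ω.1 + 1)) : Point β ω :=
  ⟨(x, (exists_mem_slice hω hβ k).choose), (exists_mem_slice hω hβ k).choose_spec.1,
    fun i _ => (exists_mem_slice hω hβ k).choose_spec.2.2 i⟩

theorem slicePoint_fst (hω : Regular β ω) (hβ : 0 < β) (x : V) (k : Fin (ω.1 + 1)) :
    (slicePoint hω hβ x k).1.1 = x := rfl

theorem slice_slicePoint (hω : Regular β ω) (hβ : 0 < β) (x : V) (k : Fin (ω.1 + 1)) :
    slice (times ω.2) (slicePoint hω hβ x k).1.2 = k :=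
  (exists_mem_slice hω hβ k).choose_spec.2.1

theorem times_ne_slicePoint (hω : Regular β ω) (hβ : 0 < β) (x : V) (k : Fin (ω.1 + 1))
    (i : Fin ω.1) : times ω.2 i ≠ (slicePoint hω hβ x k).1.2 :=
  (exists_mem_slice hω hβ k).choose_spec.2.2 i

theorem times_lt_slicePoint (hω : Regular β ω) (hβ : 0 < β) {x : V} {k : Fin (ω.1 + 1)}
    {i : Fin ω.1} :
    times ω.2 i < (slicePoint hω hβ x k).1.2 ↔ (rank (times ω.2) i).castSucc < k := by
  rw [← castSucc_rank_lt_slice, slice_slicePoint]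

theorem slicePoint_lt_times (hω : Regular β ω) (hβ : 0 < β) {x : V} {k : Fin (ω.1 + 1)}
    {i : Fin ω.1} :
    (slicePoint hω hβ x k).1.2 < times ω.2 i ↔ k ≤ (rank (times ω.2) i).castSucc := by
  rw [← not_lt, ← times_lt_slicePoint hω hβ (x := x), not_lt]
  exact ⟨le_of_lt, fun h => lt_of_le_of_ne h (times_ne_slicePoint hω hβ x k i).symm⟩

/-- The directed point that represents a directed vertical element. -/
def sliceMk (hω : Regular β ω) (hβ : 0 < β) (z : V × Fin (ω.1 + 1) × Bool) : OrientedLoop β ω :=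
  Quot.mk _ (slicePoint hω hβ z.1 z.2.1, z.2.2)

theorem mk_eq_mk_of_slice_eq {p q : Point β ω} (hx : p.1.1 = q.1.1)
    (hs : slice (times ω.2) p.1.2 = slice (times ω.2) q.1.2) (d : Bool) :
    (Quot.mk _ (p, d) : OrientedLoop β ω) = Quot.mk _ (q, d) := by
  refine Quot.sound (Step.vertical p q d hx fun i hi hmem => ?_)
  have hp : times ω.2 i ≠ p.1.2 := fun h => p.2.2 i hi h
  have hq : times ω.2 i ≠ q.1.2 := fun h => q.2.2 i (hx ▸ hi) h
  have hiff : times ω.2 i < p.1.2 ↔ times ω.2 i < q.1.2 := by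
    rw [← castSucc_rank_lt_slice, hs, castSucc_rank_lt_slice]
  rcases Set.mem_uIcc.1 hmem with ⟨ha, hb⟩ | ⟨ha, hb⟩
  · exact (hiff.2 (lt_of_le_of_ne hb hq)).not_ge ha
  · exact (hiff.1 (lt_of_le_of_ne hb hp)).not_ge ha

theorem mk_eq_sliceMk (hω : Regular β ω) (hβ : 0 < β) (z : Point β ω × Bool) :
    (Quot.mk _ z : OrientedLoop β ω) = sliceMk hω hβ (code z) :=
  mk_eq_mk_of_slice_eq (p := z.1)
    (q := slicePoint hω hβ z.1.1.1 (slice (times ω.2) z.1.1.2)) rfl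
    (slice_slicePoint hω hβ _ _).symm z.2

theorem sliceMk_reverse (hω : Regular β ω) (hβ : 0 < β) {z w : V × Fin (ω.1 + 1) × Bool}
    (h : sliceMk hω hβ z = sliceMk hω hβ w) :
    sliceMk hω hβ (reverse z) = sliceMk hω hβ (reverse w) :=
  OrientedLoop.mk_reverse h

theorem sliceMk_last (hω : Regular β ω) (hβ : 0 < β) (x : V) :
    sliceMk hω hβ (x, Fin.last ω.1, true) = sliceMk hω hβ (x, 0, true) := by
  refine Quot.sound (Step.periodic _ _ true rfl (fun i _ hi => ?_) (fun i _ hi => ?_))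
  · exact ((times_lt_slicePoint hω hβ).2 (Fin.castSucc_lt_last _)).not_ge hi.1
  · exact ((slicePoint_lt_times hω hβ).2 (Fin.zero_le _)).not_ge hi.2

theorem clear_Ico_slicePoint (hω : Regular β ω) (hβ : 0 < β) (x : V) (i : Fin ω.1) :
    Clear ω x (Set.Ico (slicePoint hω hβ x (rank (times ω.2) i).castSucc).1.2 (times ω.2 i)) :=
  fun j _ hj => by
    have h1 := (slicePoint_lt_times hω hβ).1
      (lt_of_le_of_ne hj.1 (times_ne_slicePoint hω hβ x _ j).symm)
    exact (rank_lt_rank.2 hj.2).not_ge (Fin.castSucc_le_castSucc_iff.1 h1)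

theorem clear_Ioc_slicePoint (hω : Regular β ω) (hβ : 0 < β) (x : V) (i : Fin ω.1) :
    Clear ω x (Set.Ioc (times ω.2 i) (slicePoint hω hβ x (rank (times ω.2) i).succ).1.2) :=
  fun j _ hj => by
    have h1 := (times_lt_slicePoint hω hβ).1
      (lt_of_le_of_ne hj.2 (times_ne_slicePoint hω hβ x _ j))
    exact (rank_lt_rank.2 hj.1).not_ge (Fin.castSucc_lt_succ_iff.1 h1)

theorem slicePoint_lt (hω : Regular β ω) (hβ : 0 < β) (x : V) (i : Fin ω.1) :
    (slicePoint hω hβ x (rank (times ω.2) i).castSucc).1.2 < times ω.2 i :=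
  (slicePoint_lt_times hω hβ).2 le_rfl

theorem lt_slicePoint (hω : Regular β ω) (hβ : 0 < β) (x : V) (i : Fin ω.1) :
    times ω.2 i < (slicePoint hω hβ x (rank (times ω.2) i).succ).1.2 :=
  (times_lt_slicePoint hω hβ).2 Fin.castSucc_lt_succ

theorem sliceMk_cross (hω : Regular β ω) (hβ : 0 < β) {x : V} {i : Fin ω.1}
    (hx : x ∈ ((ω.2 i).1 : Sym2 V)) (hk : (ω.2 i).2.1 = Kind.cross) :
    sliceMk hω hβ (x, (rank (times ω.2) i).castSucc, true) =
      sliceMk hω hβ (edgeSwap ((ω.2 i).1 : Sym2 V) x, (rank (times ω.2) i).succ, true) :=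
  Quot.sound (Step.cross _ _ true (times ω.2 i) ⟨i, eq_mk_edgeSwap hx, hk, rfl⟩
    (slicePoint_lt hω hβ _ i) (lt_slicePoint hω hβ _ i)
    (clear_Ico_slicePoint hω hβ _ i) (clear_Ioc_slicePoint hω hβ _ i))

theorem sliceMk_barBelow (hω : Regular β ω) (hβ : 0 < β) {x : V} {i : Fin ω.1}
    (hx : x ∈ ((ω.2 i).1 : Sym2 V)) (hk : (ω.2 i).2.1 = Kind.bar) :
    sliceMk hω hβ (x, (rank (times ω.2) i).castSucc, true) =
      sliceMk hω hβ (edgeSwap ((ω.2 i).1 : Sym2 V) x, (rank (times ω.2) i).castSucc, false) :=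
  Quot.sound (Step.barBelow _ _ true (times ω.2 i) ⟨i, eq_mk_edgeSwap hx, hk, rfl⟩
    (slicePoint_lt hω hβ _ i) (slicePoint_lt hω hβ _ i)
    (clear_Ico_slicePoint hω hβ _ i) (clear_Ico_slicePoint hω hβ _ i))

theorem sliceMk_barAbove (hω : Regular β ω) (hβ : 0 < β) {x : V} {i : Fin ω.1}
    (hx : x ∈ ((ω.2 i).1 : Sym2 V)) (hk : (ω.2 i).2.1 = Kind.bar) :
    sliceMk hω hβ (x, (rank (times ω.2) i).succ, false) =
      sliceMk hω hβ (edgeSwap ((ω.2 i).1 : Sym2 V) x, (rank (times ω.2) i).succ, true) :=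
  Quot.sound (Step.barAbove _ _ false (times ω.2 i) ⟨i, eq_mk_edgeSwap hx, hk, rfl⟩
    (lt_slicePoint hω hβ _ i) (lt_slicePoint hω hβ _ i)
    (clear_Ioc_slicePoint hω hβ _ i) (clear_Ioc_slicePoint hω hβ _ i))

theorem sliceMk_of_notMem (hω : Regular β ω) (hβ : 0 < β) {x : V} {i : Fin ω.1}
    (hx : x ∉ ((ω.2 i).1 : Sym2 V)) :
    sliceMk hω hβ (x, (rank (times ω.2) i).castSucc, true) =
      sliceMk hω hβ (x, (rank (times ω.2) i).succ, true) := by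
  refine Quot.sound (Step.vertical _ _ true rfl fun j hj hmem => hx ?_)
  change times ω.2 j ∈ _ at hmem
  rw [Set.uIcc_of_le ((slicePoint_lt hω hβ x i).trans (lt_slicePoint hω hβ x i)).le] at hmem
  rcases lt_trichotomy (times ω.2 j) (times ω.2 i) with h | h | h
  · exact absurd ⟨hmem.1, h⟩ (clear_Ico_slicePoint hω hβ x i j hj)
  · exact hω.1 h ▸ hj
  · exact absurd ⟨h, hmem.2⟩ (clear_Ioc_slicePoint hω hβ x i j hj)

/-- Each junction of the discrete model is realized by a displacement of space-time points. This is
the converse of `Step.sameCycle`: the motion on vertical elements stays on one oriented loop. -/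
theorem sliceMk_place (hω : Regular β ω) (hβ : 0 < β) (m : Fin (ω.1 + 1)) (r : V × Bool) :
    sliceMk hω hβ (place m r) =
      sliceMk hω hβ (reverse (place m (joint (boundary ω m) r))) := by
  -- Reversal exchanges the two ends of a junction, so for junctions joining below to above only the
  -- upward passage needs checking.
  have hsymm : ∀ r, sliceMk hω hβ (place m r) =
      sliceMk hω hβ (reverse (place m (joint (boundary ω m) r))) →
      sliceMk hω hβ (place m (joint (boundary ω m) r)) =
        sliceMk hω hβ (reverse (place m (joint (boundary ω m) (joint (boundary ω m) r)))) := by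
    intro r h
    rw [joint_joint]
    have := (sliceMk_reverse hω hβ h).symm
    rwa [reverse_reverse] at this
  have hred : ∀ x y : V, joint (boundary ω m) (x, true) = (y, false) →
      sliceMk hω hβ (x, m, true) = sliceMk hω hβ (y, m + 1, true) →
      sliceMk hω hβ (place m (x, true)) =
      sliceMk hω hβ (reverse (place m (joint (boundary ω m) (x, true)))) := by
    intro x y hxy h
    rw [hxy]
    exact h
  have hred' : ∀ x y : V, joint (boundary ω m) (x, true) = (y, false) →
      sliceMk hω hβ (x, m, true) = sliceMk hω hβ (y, m + 1, true) →
      sliceMk hω hβ (place m (y, false)) =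
      sliceMk hω hβ (reverse (place m (joint (boundary ω m) (y, false)))) := by
    intro x y hxy h
    have := hsymm _ (hred x y hxy h)
    rwa [hxy] at this
  obtain ⟨x, s⟩ := r
  induction m using Fin.lastCases with
  | last =>
    have h1 : joint (boundary ω (Fin.last ω.1)) (x, true) = (x, false) := by
      rw [boundary_last]; rfl
    have h2 := sliceMk_last hω hβ x
    rw [← Fin.last_add_one] at h2
    cases s
    · exact hred' x x h1 h2
    · exact hred x x h1 h2
  | cast j =>
    obtain ⟨i, rfl⟩ := rank_surjective hω.1 j
    have hb := boundary_rank hω i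
    by_cases hx : x ∈ ((ω.2 i).1 : Sym2 V)
    · cases hk : (ω.2 i).2.1 with
      | cross =>
        have h1 : ∀ y, joint (boundary ω (rank (times ω.2) i).castSucc) (y, true) =
            (edgeSwap ((ω.2 i).1 : Sym2 V) y, false) := fun y => by
          rw [hb, hk]; rfl
        cases s
        · have h := hred' _ _ (h1 (edgeSwap ((ω.2 i).1 : Sym2 V) x)) (by
            rw [Fin.coeSucc_eq_succ]
            exact sliceMk_cross hω hβ (edgeSwap_mem hx) hk)
          rwa [edgeSwap_edgeSwap] at h
        · refine hred _ _ (h1 x) ?_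
          rw [Fin.coeSucc_eq_succ]
          exact sliceMk_cross hω hβ hx hk
      | bar =>
        have h1 : joint (boundary ω (rank (times ω.2) i).castSucc) (x, s) =
            (edgeSwap ((ω.2 i).1 : Sym2 V) x, s) := by
          rw [hb, hk]; simp [joint, hx]
        rw [h1]
        cases s
        · simp only [place, Fin.coeSucc_eq_succ]
          exact sliceMk_barAbove hω hβ hx hk
        · exact sliceMk_barBelow hω hβ hx hk
    · have h1 : joint (boundary ω (rank (times ω.2) i).castSucc) (x, true) = (x, false) := by
        refine joint_of_notMem (fun e k he => ?_) true
        rw [hb] at he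
        simp only [Option.some.injEq, Prod.mk.injEq] at he
        exact he.1 ▸ hx
      have h2 := sliceMk_of_notMem hω hβ hx
      rw [← Fin.coeSucc_eq_succ] at h2
      cases s
      · exact hred' x x h1 h2
      · exact hred x x h1 h2

theorem sliceMk_follow (hω : Regular β ω) (hβ : 0 < β) (z : V × Fin (ω.1 + 1) × Bool) :
    sliceMk hω hβ (follow (boundary ω) z) = sliceMk hω hβ z := by
  rw [follow, Equiv.Perm.mul_apply, turnPerm_apply, place_surjective z, turn_place,
    ← sliceMk_place]

/-! ### Space-time configurations and spins of loops -/

/-- The spin of a configuration along a directed vertical element. -/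
def directedSpin (c : Fin (ω.1 + 1) → Config V S) (z : V × Fin (ω.1 + 1) × Bool) : ℤ :=
  if z.2.2 then (c z.2.1 z.1 : ℤ) else -(c z.2.1 z.1 : ℤ)

theorem directedSpin_reverse (c : Fin (ω.1 + 1) → Config V S) (z : V × Fin (ω.1 + 1) × Bool) :
    directedSpin c (reverse z) = -directedSpin c z := by
  obtain ⟨x, k, _ | _⟩ := z <;> simp [directedSpin]

/-- Both ends of a junction are directed towards it, so conservation of the spin along the motion
through it reads as a change of sign. This one condition covers crosses, double bars and untouched
sites. -/
theorem rel_iff_joint (e : Sym2 V) (k : Kind) (σ τ : Config V S) :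
    Rel e k σ τ ↔ ∀ r : V × Bool,
      (fun r : V × Bool => if r.2 then (τ r.1 : ℤ) else -(σ r.1 : ℤ)) (joint (some (e, k)) r) =
        -(fun r : V × Bool => if r.2 then (τ r.1 : ℤ) else -(σ r.1 : ℤ)) r := by
  cases k with
  | cross =>
    simp only [Rel, joint, Prod.forall, Bool.forall_bool]
    constructor
    · intro h x
      have h1 := h (edgeSwap e x)
      rw [edgeSwap_edgeSwap] at h1
      simp [h, h1]
    · intro h x
      have := (h x).2
      simp only [Bool.not_true, Bool.false_eq_true, if_false, if_true, neg_inj] at this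
      exact Subtype.ext this
  | bar =>
    simp only [Rel, joint, Prod.forall, Bool.forall_bool]
    constructor
    · rintro ⟨h1, h2⟩ x
      by_cases hx : x ∈ e
      · simp [hx, h2 x hx]
      · simp [hx, h1 x hx]
    · intro h
      refine ⟨fun x hx => ?_, fun x hx => ?_⟩
      · have := (h x).2
        simp only [hx, if_false, if_true, Bool.not_true, Bool.false_eq_true, neg_inj] at this
        exact Subtype.ext this
      · have := h x
        simp only [hx, if_false, if_true, Bool.false_eq_true, neg_neg] at this
        omega

/-- Periodicity is the sign condition at the last boundary, and compatibility is the sign condition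
at the others, which the transitions enumerate by rank. -/
theorem compatible_iff (hω : Regular β ω) (c : Fin (ω.1 + 1) → Config V S) :
    c 0 = c (Fin.last ω.1) ∧ Compatible ω.2 c ↔
      ∀ z, directedSpin c (turn (boundary ω) z) = -directedSpin c z := by
  have hpl : ∀ m r, directedSpin c (place m r) =
      (fun r : V × Bool => if r.2 then (c m r.1 : ℤ) else -(c (m + 1) r.1 : ℤ)) r := by
    rintro m ⟨x, _ | _⟩ <;> simp [directedSpin, place]
  have h1 : (∀ z, directedSpin c (turn (boundary ω) z) = -directedSpin c z) ↔
      ∀ m r, directedSpin c (place m (joint (boundary ω m) r)) = -directedSpin c (place m r) := by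
    constructor
    · intro h m r
      rw [← turn_place, h]
    · intro h z
      rw [place_surjective z, turn_place, h]
  rw [h1, Fin.forall_fin_succ', and_comm, Compatible]
  refine and_congr ?_ ?_
  · have key : ∀ i, (∀ r, directedSpin c (place (rank (times ω.2) i).castSucc
        (joint (boundary ω (rank (times ω.2) i).castSucc) r)) =
          -directedSpin c (place (rank (times ω.2) i).castSucc r)) ↔
        Rel (ω.2 i).1 (ω.2 i).2.1 (c (rank (times ω.2) i).succ)
          (c (rank (times ω.2) i).castSucc) := fun i => by
      simp only [boundary_rank hω, hpl, Fin.coeSucc_eq_succ]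
      exact (rel_iff_joint _ _ _ _).symm
    constructor
    · intro h j
      obtain ⟨i, rfl⟩ := rank_surjective hω.1 j
      exact (key i).2 (h i)
    · exact fun h i => (key i).1 (h _)
  · simp only [hpl, boundary_last, Fin.last_add_one, joint, Prod.forall, Bool.forall_bool]
    constructor
    · intro h x
      simp [h]
    · intro h
      funext x
      have := (h x).1
      simp only [Bool.not_false, if_true, Bool.false_eq_true, if_false, neg_neg] at this
      exact Subtype.ext this.symm

theorem directedSpin_sameCycle (hω : Regular β ω) {c : Fin (ω.1 + 1) → Config V S}
    (hc : c 0 = c (Fin.last ω.1) ∧ Compatible ω.2 c) {z w : V × Fin (ω.1 + 1) × Bool}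
    (h : (follow (boundary ω)).SameCycle z w) : directedSpin c z = directedSpin c w := by
  have hf : ∀ z, directedSpin c (follow (boundary ω) z) = directedSpin c z := fun z => by
    rw [follow, Equiv.Perm.mul_apply, directedSpin_reverse, turnPerm_apply,
      (compatible_iff hω c).1 hc, neg_neg]
  -- Cycles are finite, so a natural power suffices.
  obtain ⟨k, -, rfl⟩ := h.exists_pow_eq'
  induction k with
  | zero => rfl
  | succ k ih => rw [pow_succ', Equiv.Perm.mul_apply, hf, ← ih ⟨k, rfl⟩]

theorem directedSpin_mem (c : Fin (ω.1 + 1) → Config V S) (z : V × Fin (ω.1 + 1) × Bool) :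
    directedSpin c z ∈ Finset.Icc (-(S : ℤ)) (S : ℤ) := by
  have := (c z.2.1 z.1).2
  rw [Finset.mem_Icc] at this ⊢
  unfold directedSpin
  split_ifs <;> omega

/-- The spins of the loops in a space-time configuration, for given orientations. -/
def loopSpin (o : Loop β ω → OrientedLoop β ω) (c : Fin (ω.1 + 1) → Config V S)
    (γ : Loop β ω) : Spin S :=
  ⟨directedSpin c (code (o γ).out), directedSpin_mem c _⟩

theorem loopSpin_eq (hω : Regular β ω) {o : Loop β ω → OrientedLoop β ω}
    {c : Fin (ω.1 + 1) → Config V S} (hc : c 0 = c (Fin.last ω.1) ∧ Compatible ω.2 c)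
    {γ : Loop β ω} {z : Point β ω × Bool} (hz : Quot.mk _ z = o γ) :
    (loopSpin o c γ : ℤ) = directedSpin c (code z) :=
  directedSpin_sameCycle hω hc (OrientedLoop.sameCycle_of_mk_eq hω ((Quot.out_eq _).trans hz.symm))

theorem exists_mk_eq {o : Loop β ω → OrientedLoop β ω} (ho : ∀ γ, (o γ).forget = γ)
    (p : Point β ω) : ∃ d, (Quot.mk _ (p, d) : OrientedLoop β ω) = o (Quot.mk _ p) := by
  rcases OrientedLoop.eq_mk_or (ho (Quot.mk _ p)) with h | h
  · exact ⟨true, h.symm⟩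
  · exact ⟨false, h.symm⟩

/-- Every vertical element lies on a loop, in one direction of its chosen orientation, so the spin
of that loop determines the spin there. -/
theorem loopSpin_injective (hω : Regular β ω) (hβ : 0 < β) {o : Loop β ω → OrientedLoop β ω}
    (ho : ∀ γ, (o γ).forget = γ) {c c' : Fin (ω.1 + 1) → Config V S}
    (hc : c 0 = c (Fin.last ω.1) ∧ Compatible ω.2 c)
    (hc' : c' 0 = c' (Fin.last ω.1) ∧ Compatible ω.2 c') (h : loopSpin o c = loopSpin o c') :
    c = c' := by
  funext k x
  obtain ⟨d, hd⟩ := exists_mk_eq ho (slicePoint hω hβ x k)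
  have h1 := loopSpin_eq hω hc hd
  rw [h, loopSpin_eq hω hc' hd] at h1
  simp only [code, slicePoint_fst, slice_slicePoint, directedSpin] at h1
  apply Subtype.ext
  cases d <;> simpa using h1.symm

/-- The opposite spin value. -/
def Spin.neg (a : Spin S) : Spin S :=
  ⟨-(a : ℤ), by have := a.2; rw [Finset.mem_Icc] at this ⊢; omega⟩

theorem exists_loopSpin_eq (hω : Regular β ω) (hβ : 0 < β) {o : Loop β ω → OrientedLoop β ω}
    (ho : ∀ γ, (o γ).forget = γ) (a : Loop β ω → Spin S) :
    ∃ c : Fin (ω.1 + 1) → Config V S,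
      (c 0 = c (Fin.last ω.1) ∧ Compatible ω.2 c) ∧ loopSpin o c = a := by
  classical
  -- The odd extension of `a` to oriented loops: `a` on the chosen orientation and its opposite on
  -- the other. The two orientations being distinct, it changes sign under reversal and is the
  -- directed spin of a configuration `c`.
  let g : OrientedLoop β ω → ℤ := fun η =>
    if η = o η.forget then (a η.forget : ℤ) else -(a η.forget : ℤ)
  let c : Fin (ω.1 + 1) → Config V S := fun k x =>
    if sliceMk hω hβ (x, k, true) = o (sliceMk hω hβ (x, k, true)).forget
    then a (sliceMk hω hβ (x, k, true)).forget
    else Spin.neg (a (sliceMk hω hβ (x, k, true)).forget)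
  have hcg : ∀ z, directedSpin c z = g (sliceMk hω hβ z) := by
    rintro ⟨x, k, d⟩
    have htrue : (c k x : ℤ) = g (sliceMk hω hβ (x, k, true)) := by
      simp only [c, g]
      split_ifs <;> rfl
    cases d with
    | true => simpa [directedSpin] using htrue
    | false =>
      have hf : (sliceMk hω hβ (x, k, false)).forget = (sliceMk hω hβ (x, k, true)).forget := rfl
      have hne : sliceMk hω hβ (x, k, true) ≠ sliceMk hω hβ (x, k, false) :=
        OrientedLoop.mk_ne_mk_not hω _ true
      have hor : o (sliceMk hω hβ (x, k, true)).forget = sliceMk hω hβ (x, k, true) ∨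
          o (sliceMk hω hβ (x, k, true)).forget = sliceMk hω hβ (x, k, false) :=
        OrientedLoop.eq_mk_or (ho _)
      simp only [directedSpin, htrue, g, hf, Bool.false_eq_true, if_false]
      rcases hor with h | h
      · rw [h, if_pos rfl, if_neg hne.symm]
      · rw [h, if_neg hne, if_pos rfl, neg_neg]
  refine ⟨c, (compatible_iff hω c).2 fun z => ?_, ?_⟩
  · have h1 : directedSpin c (follow (boundary ω) z) = directedSpin c z := by
      rw [hcg, hcg, sliceMk_follow]
    rw [follow, Equiv.Perm.mul_apply, directedSpin_reverse, turnPerm_apply] at h1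
    omega
  · funext γ
    apply Subtype.ext
    change directedSpin c (code (o γ).out) = _
    have hout : (Quot.mk _ (o γ).out : OrientedLoop β ω) = o γ := Quot.out_eq _
    rw [hcg, ← mk_eq_sliceMk, hout]
    simp [g, ho]

end Bijection

/-! ### Lengths of loops and factorization of the trace into weights -/

section Weights

variable {V : Type*} [Fintype V] [DecidableEq V] {S : ℕ} {G : SimpleGraph V} {β : ℝ}
  {ω : Realization G}

/-- The times at which an oriented loop visits a site in a given direction. -/
def OrientedLoop.support (γ : OrientedLoop β ω) (x : V) (d : Bool) : Set ℝ :=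
  {t : ℝ | ∃ ht : t ∈ Set.Ioo 0 β ∧ Clear ω x {t},
    (Quot.mk _ (⟨(x, t), ht⟩, d) : OrientedLoop β ω) = γ}

theorem OrientedLoop.support_subset (γ : OrientedLoop β ω) (x : V) (d : Bool) :
    γ.support x d ⊆ Set.Ioc 0 β := fun _ ⟨ht, _⟩ => Set.Ioo_subset_Ioc_self ht.1

theorem measurableSet_clear (x : V) : MeasurableSet {t | Clear ω x {t}} := by
  have : {t | Clear ω x {t}} = ⋂ i : Fin ω.1,
      {t | x ∈ ((ω.2 i).1 : Sym2 V) → times ω.2 i ∉ ({t} : Set ℝ)} := by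
    ext t
    simp only [Set.mem_iInter]
    rfl
  rw [this]
  refine MeasurableSet.iInter fun i => ?_
  by_cases hx : x ∈ ((ω.2 i).1 : Sym2 V)
  · simp only [hx, Set.mem_singleton_iff, forall_true_left]
    exact (measurableSet_eq_fun measurable_const measurable_id).compl
  · simp [hx]

theorem OrientedLoop.measurableSet_support (hω : Regular β ω) (hβ : 0 < β)
    (γ : OrientedLoop β ω) (x : V) (d : Bool) : MeasurableSet (γ.support x d) := by
  have h : γ.support x d = (Set.Ioo 0 β ∩ {t | Clear ω x {t}}) ∩
      {t | sliceMk hω hβ (x, slice (times ω.2) t, d) = γ} := by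
    ext t
    constructor
    · rintro ⟨ht, h⟩
      exact ⟨ht, (mk_eq_sliceMk hω hβ (⟨(x, t), ht⟩, d)).symm.trans h⟩
    · rintro ⟨ht, h⟩
      exact ⟨ht, (mk_eq_sliceMk hω hβ (⟨(x, t), ht⟩, d)).trans h⟩
  rw [h]
  refine (measurableSet_Ioo.inter (measurableSet_clear x)).inter ?_
  exact (measurable_comp_slice (times ω.2)
    fun k => sliceMk hω hβ (x, k, d) = γ).setOf

/-- Exactly one loop passes through the point, in exactly one direction; its spin with the sign of
that direction is the spin there. -/
theorem sum_loopSpin_indicator (hω : Regular β ω) [Fintype (Loop β ω)]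
    {o : Loop β ω → OrientedLoop β ω} (ho : ∀ γ, (o γ).forget = γ)
    {c : Fin (ω.1 + 1) → Config V S} (hc : c 0 = c (Fin.last ω.1) ∧ Compatible ω.2 c) {x : V}
    {t : ℝ} (ht : t ∈ Set.Ioo 0 β ∧ Clear ω x {t}) :
    ∑ γ, ((loopSpin o c γ : ℤ) : ℝ) * (((o γ).support x true).indicator 1 t -
      ((o γ).support x false).indicator 1 t) = ((c (slice (times ω.2) t) x : ℤ) : ℝ) := by
  classical
  let p : Point β ω := ⟨(x, t), ht⟩
  have hmem : ∀ (γ : OrientedLoop β ω) d,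
      t ∈ γ.support x d ↔ (Quot.mk _ (p, d) : OrientedLoop β ω) = γ :=
    fun γ d => ⟨fun ⟨_, h⟩ => h, fun h => ⟨ht, h⟩⟩
  let γ₀ : Loop β ω := Quot.mk _ p
  rw [Finset.sum_eq_single γ₀]
  rotate_left
  · intro γ _ hγ
    have hn : ∀ d, t ∉ (o γ).support x d := fun d hd => by
      have := congrArg OrientedLoop.forget ((hmem _ d).1 hd)
      rw [ho] at this
      exact hγ this.symm
    simp [hn]
  · simp
  obtain ⟨d, hd⟩ : ∃ d, (Quot.mk _ (p, d) : OrientedLoop β ω) = o γ₀ := exists_mk_eq ho p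
  have hs := loopSpin_eq hω hc hd
  have hm : ∀ d', t ∈ (o γ₀).support x d' ↔ d' = d := fun d' => by
    refine (hmem _ d').trans ⟨fun h => ?_, fun h => h ▸ hd⟩
    by_contra hdd
    obtain rfl : d' = !d := by cases d <;> cases d' <;> simp_all
    exact OrientedLoop.mk_ne_mk_not hω p d (hd.trans h.symm)
  simp only [Set.indicator_apply, hm, hs]
  cases d <;> simp [directedSpin, code, p]

theorem integral_spin (hω : Regular β ω) (hβ : 0 < β) [Fintype (Loop β ω)]
    {o : Loop β ω → OrientedLoop β ω} (ho : ∀ γ, (o γ).forget = γ)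
    {c : Fin (ω.1 + 1) → Config V S} (hc : c 0 = c (Fin.last ω.1) ∧ Compatible ω.2 c) (x : V) :
    ∫ t in (0 : ℝ)..β, ((c (slice (times ω.2) t) x : ℤ) : ℝ) =
      ∑ γ, ((loopSpin o c γ : ℤ) : ℝ) * ((o γ).length x true - (o γ).length x false) := by
  have hm := fun γ : Loop β ω => OrientedLoop.measurableSet_support hω hβ (o γ) x
  have hint : ∀ γ d, Integrable (((o γ).support x d).indicator (1 : ℝ → ℝ))
      (volume.restrict (Set.Ioc 0 β)) := fun γ d =>
    (integrable_const (1 : ℝ)).indicator (hm γ d)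
  have hlen : ∀ γ d, ∫ t in Set.Ioc 0 β, ((o γ).support x d).indicator (1 : ℝ → ℝ) t =
      (o γ).length x d := fun γ d => by
    rw [integral_indicator_one (hm γ d), measureReal_restrict_apply (hm γ d),
      Set.inter_eq_left.2 (OrientedLoop.support_subset _ x d)]
    rfl
  -- The pointwise identity is used away from the transition times and the end point `β`, a finite
  -- set.
  have hae : (fun t => ((c (slice (times ω.2) t) x : ℤ) : ℝ)) =ᵐ[volume.restrict (Set.Ioc 0 β)]
      fun t => ∑ γ, ((loopSpin o c γ : ℤ) : ℝ) * (((o γ).support x true).indicator 1 t -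
        ((o γ).support x false).indicator 1 t) := by
    have hfin : ({β} ∪ Set.range (times ω.2)).Finite :=
      (Set.finite_singleton β).union (Set.finite_range _)
    rw [Filter.EventuallyEq, ae_restrict_iff' measurableSet_Ioc]
    filter_upwards [measure_eq_zero_iff_ae_notMem.1 (hfin.measure_zero volume)] with t ht ht'
    simp only [Set.singleton_union, Set.mem_insert_iff, Set.mem_range, not_or, not_exists] at ht
    exact (sum_loopSpin_indicator hω ho hc
      ⟨⟨ht'.1, lt_of_le_of_ne ht'.2 ht.1⟩, fun i _ hi => ht.2 i hi⟩).symm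
  have hint' : ∀ γ, Integrable (fun t => ((loopSpin o c γ : ℤ) : ℝ) *
      (((o γ).support x true).indicator 1 t - ((o γ).support x false).indicator 1 t))
      (volume.restrict (Set.Ioc 0 β)) := fun γ => ((hint γ true).sub (hint γ false)).const_mul _
  rw [intervalIntegral.integral_of_le hβ.le, integral_congr_ae hae,
    integral_finsetSum _ fun γ _ => hint' γ]
  refine Finset.sum_congr rfl fun γ _ => ?_
  rw [integral_const_mul, integral_sub (hint γ true) (hint γ false), hlen, hlen]

theorem integral_field (hω : Regular β ω) (hβ : 0 < β) [Fintype (Loop β ω)]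
    {o : Loop β ω → OrientedLoop β ω} (ho : ∀ γ, (o γ).forget = γ)
    {c : Fin (ω.1 + 1) → Config V S} (hc : c 0 = c (Fin.last ω.1) ∧ Compatible ω.2 c)
    (h : V → ℝ) :
    ∫ t in (0 : ℝ)..β, field h (c (slice (times ω.2) t)) =
      ∑ γ, ((loopSpin o c γ : ℤ) : ℝ) *
        ∑ x, h x * ((o γ).length x true - (o γ).length x false) := by
  simp only [field]
  rw [intervalIntegral.integral_finsetSum fun x _ => (intervalIntegrable_comp_slice (times ω.2)
    (fun k => ((c k x : ℤ) : ℝ)) 0 β).const_mul (h x)]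
  simp only [intervalIntegral.integral_const_mul, integral_spin hω hβ ho hc, Finset.mul_sum]
  rw [Finset.sum_comm]
  exact Finset.sum_congr rfl fun _ _ => Finset.sum_congr rfl fun _ _ => by ring

/-- The trace of the time-ordered product is the product of the weights of the loops. -/
theorem trace_evolution (hω : Regular β ω) (hβ : 0 < β) {o : Loop β ω → OrientedLoop β ω}
    (ho : ∀ γ, (o γ).forget = γ) (h : V → ℝ) :
    ∑ σ : Config V S, evolution (field h) ω.1 ω.2 β σ σ =
      ENNReal.ofReal (∏ᶠ γ, weight S h (o γ)) := by
  classical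
  have := Fintype.ofFinite (Loop β ω)
  -- Taking the trace identifies the first and last configurations, which makes the paths periodic.
  have h1 : ∀ c : Fin (ω.1 + 1) → Config V S, (∑ σ, if c 0 = σ ∧ c (Fin.last ω.1) = σ ∧
      Compatible ω.2 c then ENNReal.ofReal (Real.exp (∫ s in (0 : ℝ)..β,
        field h (c (slice (times ω.2) s)))) else 0) =
      if c 0 = c (Fin.last ω.1) ∧ Compatible ω.2 c then ENNReal.ofReal (Real.exp
        (∫ s in (0 : ℝ)..β, field h (c (slice (times ω.2) s)))) else 0 := by
    intro c
    rw [Finset.sum_eq_single (c 0)]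
    · simp [eq_comm]
    · intro σ _ hσ
      rw [if_neg fun hh => hσ hh.1.symm]
    · simp
  let L : Loop β ω → ℝ := fun γ => ∑ x, h x * ((o γ).length x true - (o γ).length x false)
  have h2 : ∏ᶠ γ, weight S h (o γ) =
      ∑ a : Loop β ω → Spin S, Real.exp (∑ γ, ((a γ : ℤ) : ℝ) * L γ) := by
    rw [finprod_eq_prod_of_fintype]
    simp only [Real.exp_sum]
    rw [← Fintype.prod_sum fun γ (a : Spin S) => Real.exp (((a : ℤ) : ℝ) * L γ)]
    refine Finset.prod_congr rfl fun γ _ => ?_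
    exact (Finset.sum_coe_sort (Finset.Icc (-(S : ℤ)) (S : ℤ))
      fun a : ℤ => Real.exp ((a : ℝ) * L γ)).symm
  simp only [evolution_eq_sum (field h) hω.1 (fun i => (hω.2 i).1.le) fun i => (hω.2 i).2]
  rw [Finset.sum_comm, Finset.sum_congr rfl fun c _ => h1 c, ← Finset.sum_filter, h2,
    ENNReal.ofReal_sum_of_nonneg fun _ _ => Real.exp_nonneg _]
  refine Finset.sum_bij (fun c _ => loopSpin o c) (fun _ _ => Finset.mem_univ _) ?_ ?_ ?_
  · intro c hc c' hc' hcc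
    exact loopSpin_injective hω hβ ho (Finset.mem_filter.1 hc).2 (Finset.mem_filter.1 hc').2 hcc
  · intro a _
    obtain ⟨c, hc, hca⟩ := exists_loopSpin_eq hω hβ ho a
    exact ⟨c, by simpa using hc, hca⟩
  · intro c hc
    rw [integral_field hω hβ ho (Finset.mem_filter.1 hc).2]

theorem weight_nonneg (S : ℕ) (h : V → ℝ) (γ : OrientedLoop β ω) : 0 ≤ weight S h γ :=
  Finset.sum_nonneg fun _ _ => Real.exp_nonneg _

end Weights

/-! ### The Poisson measure -/

section Poisson

theorem measurableSet_sigma_iff {ι : Type*} {X : ι → Type*} [∀ i, MeasurableSpace (X i)]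
    {s : Set (Sigma X)} : MeasurableSet s ↔ ∀ i, MeasurableSet (Sigma.mk i ⁻¹' s) :=
  MeasurableSpace.measurableSet_iInf

theorem measurable_sigma_of {ι E : Type*} {X : ι → Type*} [∀ i, MeasurableSpace (X i)]
    [MeasurableSpace E] {f : Sigma X → E} (hf : ∀ i, Measurable fun x => f ⟨i, x⟩) :
    Measurable f := fun _ hs => measurableSet_sigma_iff.2 fun i => hf i hs

theorem measurable_sigmaMk {ι : Type*} {X : ι → Type*} [∀ i, MeasurableSpace (X i)] (i : ι) :
    Measurable (Sigma.mk i : X i → Sigma X) := fun _ hs => measurableSet_sigma_iff.1 hs i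

theorem lintegral_poissonLaw {X : Type*} [MeasurableSpace X] (ν : Measure X)
    {f : (Σ n : ℕ, Fin n → X) → ENNReal} (hf : Measurable f) :
    ∫⁻ ω, f ω ∂(poissonLaw ν) = ∑' n : ℕ,
      ENNReal.ofReal (Real.exp (-(ν.real Set.univ)) / (n.factorial : ℝ)) *
        ∫⁻ x, f ⟨n, x⟩ ∂(Measure.pi fun _ : Fin n => ν) := by
  rw [poissonLaw, lintegral_sum_measure]
  refine tsum_congr fun n => ?_
  rw [lintegral_smul_measure, lintegral_map hf (measurable_sigmaMk n), smul_eq_mul]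

theorem ae_poissonLaw {X : Type*} [MeasurableSpace X] {ν : Measure X}
    {p : (Σ n : ℕ, Fin n → X) → Prop} (hp : MeasurableSet {ω | p ω})
    (h : ∀ n, ∀ᵐ x ∂(Measure.pi fun _ : Fin n => ν), p ⟨n, x⟩) : ∀ᵐ ω ∂(poissonLaw ν), p ω := by
  rw [poissonLaw, Measure.ae_sum_iff]
  exact fun n => Measure.ae_smul_measure
    ((ae_map_iff (measurable_sigmaMk n).aemeasurable hp).2 (h n)) _

variable {V : Type*} [Fintype V] [DecidableEq V] {S : ℕ} {G : SimpleGraph V} {u β : ℝ}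

theorem ae_intensity {s : Set ℝ} (h : ∀ᵐ t ∂(volume.restrict (Set.Icc 0 β)), t ∈ s) :
    ∀ᵐ x ∂(intensity G u β), x.2.2 ∈ s :=
  (Measure.quasiMeasurePreserving_snd.comp Measure.quasiMeasurePreserving_snd).ae h

/-- Coincidence of two given times is null by Fubini, since Lebesgue measure has no atoms; there are
finitely many pairs. -/
theorem ae_injective_times (n : ℕ) :
    ∀ᵐ ω ∂(Measure.pi fun _ : Fin n => intensity G u β), Function.Injective (times ω) := by
  have key : ∀ (n : ℕ) (i : Fin (n + 1)) (k : Fin n),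
      ∀ᵐ ω ∂(Measure.pi fun _ : Fin (n + 1) => intensity G u β),
        times ω i ≠ times ω (i.succAbove k) := by
    intro n i k
    have hmp := measurePreserving_piFinSuccAbove (fun _ : Fin (n + 1) => intensity G u β) i
    refine hmp.quasiMeasurePreserving.ae
      (p := fun x : Event G × (Fin n → Event G) => x.1.2.2 ≠ (x.2 k).2.2) ?_
    have hs : MeasurableSet {x : Event G × (Fin n → Event G) | x.1.2.2 = (x.2 k).2.2} :=
      measurableSet_eq_fun measurable_fst.snd.snd
        ((measurable_pi_apply k).comp measurable_snd).snd.snd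
    have hz := (Measure.measure_prod_null hs (μ := intensity G u β)
      (ν := Measure.pi fun _ : Fin n => intensity G u β)).2 (Filter.Eventually.of_forall fun x => by
        have h1 : ∀ᵐ y ∂(intensity G u β), y.2.2 ∈ ({x.2.2}ᶜ : Set ℝ) :=
          ae_intensity (ae_restrict_of_ae (measure_eq_zero_iff_ae_notMem.1 Real.volume_singleton))
        have h2 := (Measure.tendsto_eval_ae_ae (μ := fun _ : Fin n => intensity G u β)
          (i := k)).eventually h1
        refine measure_mono_null (fun ω hω => ?_) (ae_iff.1 h2)
        simp only [Set.mem_preimage, Set.mem_ofPred_eq] at hω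
        simp [hω])
    rw [ae_iff]
    simpa using hz
  cases n with
  | zero => exact Filter.Eventually.of_forall fun ω i => i.elim0
  | succ n =>
    filter_upwards [ae_all_iff.2 fun i => ae_all_iff.2 fun k => key n i k] with ω hω i j hij
    rcases Fin.eq_self_or_eq_succAbove i j with rfl | ⟨k, rfl⟩
    · rfl
    · exact absurd hij (hω i k)

theorem measurable_times {n : ℕ} (i : Fin n) : Measurable fun ω : Fin n → Event G => times ω i :=
  (measurable_pi_apply i).snd.snd

theorem ae_regular : ∀ᵐ ω ∂(rho G u β), Regular β ω := by
  refine ae_poissonLaw (measurableSet_sigma_iff.2 fun n => ?_) fun n => ?_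
  · have : (Sigma.mk n ⁻¹' {ω : Realization G | Regular β ω}) =
        (⋂ i, ⋂ j, {ω : Fin n → Event G | times ω i = times ω j → i = j}) ∩
          ⋂ i, {ω : Fin n → Event G | times ω i ∈ Set.Ioo 0 β} := by
      ext ω
      simp only [Set.mem_inter_iff, Set.mem_iInter]
      rfl
    rw [this]
    refine MeasurableSet.inter (MeasurableSet.iInter fun i => MeasurableSet.iInter fun j => ?_)
      (MeasurableSet.iInter fun i => measurable_times i measurableSet_Ioo)
    exact (measurableSet_eq_fun (measurable_times i) (measurable_times j)).imp
      (MeasurableSet.const _)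
  · have h1 : ∀ᵐ x ∂(intensity G u β), x.2.2 ∈ Set.Ioo 0 β := by
      refine ae_intensity ?_
      rw [← restrict_Ioo_eq_restrict_Icc]
      exact ae_restrict_mem measurableSet_Ioo
    filter_upwards [ae_injective_times n, ae_all_iff.2 fun i : Fin n =>
      (Measure.tendsto_eval_ae_ae (μ := fun _ : Fin n => intensity G u β)
        (i := i)).eventually h1] with ω hω hω'
    exact ⟨hω, hω'⟩

theorem measurable_trace_evolution (b : Config V S → ℝ) :
    Measurable fun ω : Realization G => ∑ σ, evolution b ω.1 ω.2 β σ σ :=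
  measurable_sigma_of fun n => Finset.measurable_sum _ fun σ _ =>
    (measurable_evolution b n σ σ).comp (measurable_id.prodMk measurable_const)

/-- The factorials cancel term by term, and the total mass β|E| of the intensity gives the
exponential prefactor. -/
theorem lintegral_trace_evolution [DecidableRel G.Adj] (b : Config V S → ℝ)
    (hu : u ∈ Set.Icc (0 : ℝ) 1) (hβ : 0 ≤ β) :
    ∫⁻ ω, ∑ σ, evolution b ω.1 ω.2 β σ σ ∂(rho G u β) =
      ENNReal.ofReal (Real.exp (-(β * G.edgeFinset.card)) *
        (NormedSpace.exp (β • (Matrix.diagonal b + hopping G S u) :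
          Matrix (Config V S) (Config V S) ℝ)).trace) := by
  have hK := hopping_nonneg (S := S) G hu
  have hsum : HasSum (fun n => Real.exp (-(β * G.edgeFinset.card)) *
      ∑ σ, dyson b (hopping G S u) n β σ σ) (Real.exp (-(β * G.edgeFinset.card)) *
        (NormedSpace.exp (β • (Matrix.diagonal b + hopping G S u) :
          Matrix (Config V S) (Config V S) ℝ)).trace) :=
    (hasSum_sum fun σ _ => hasSum_dyson hK hβ σ σ).mul_left _
  have h0 : ∀ n σ, 0 ≤ dyson b (hopping G S u) n β σ σ := fun n σ => dyson_nonneg hK n hβ σ σ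
  rw [rho, lintegral_poissonLaw _ (measurable_trace_evolution b), ← hsum.tsum_eq,
    ENNReal.ofReal_tsum_of_nonneg (fun n => mul_nonneg (Real.exp_nonneg _)
      (Finset.sum_nonneg fun σ _ => h0 n σ)) hsum.summable]
  refine tsum_congr fun n => ?_
  have hm : ∀ σ, Measurable fun ω : Fin n → Event G => evolution b n ω β σ σ := fun σ =>
    (measurable_evolution b n σ σ).comp (measurable_id.prodMk measurable_const)
  rw [lintegral_finsetSum _ fun σ _ => hm σ]
  simp only [lintegral_evolution b hu n ⟨hβ, le_rfl⟩]
  rw [← ENNReal.ofReal_sum_of_nonneg fun σ _ => mul_nonneg (Nat.cast_nonneg _) (h0 n σ),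
    ← ENNReal.ofReal_mul (by positivity), intensity_real_univ hu hβ, ← Finset.mul_sum]
  congr 1
  have : (n.factorial : ℝ) ≠ 0 := by positivity
  field_simp

theorem integrable_and_partitionFunction_eq [DecidableRel G.Adj] (S : ℕ)
    (hu : u ∈ Set.Icc (0 : ℝ) 1) (hβ : 0 < β)
    (h : V → ℝ)
    (o : ∀ ω : Realization G, Loop β ω → OrientedLoop β ω)
    (ho : ∀ (ω : Realization G) (γ : Loop β ω), (o ω γ).forget = γ) :
    Integrable
      (fun ω : Realization G =>
        ∏ᶠ γ : Loop β ω, weight S h (o ω γ))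
      (rho G u β) ∧
    partitionFunction G S u β h =
      ((∫ ω : Realization G,
        ∏ᶠ γ : Loop β ω, weight S h (o ω γ)
          ∂(rho G u β) : ℝ) : ℂ) := by
  have hnn : ∀ ω : Realization G, 0 ≤ ∏ᶠ γ : Loop β ω, weight S h (o ω γ) := fun ω =>
    finprod_nonneg fun γ => weight_nonneg S h (o ω γ)
  have hae : ∀ᵐ ω ∂(rho G u β), ∑ σ : Config V S, evolution (field h) ω.1 ω.2 β σ σ =
      ENNReal.ofReal (∏ᶠ γ : Loop β ω, weight S h (o ω γ)) := by
    filter_upwards [ae_regular] with ω hω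
    exact trace_evolution hω hβ (ho ω) h
  have hmeas : AEStronglyMeasurable
      (fun ω : Realization G => ∏ᶠ γ : Loop β ω, weight S h (o ω γ)) (rho G u β) := by
    -- The orientations may depend on ω in a non-measurable way; measurability comes from the almost
    -- sure equality with the trace, in which they do not appear.
    refine AEMeasurable.aestronglyMeasurable
      ⟨_, (measurable_trace_evolution (S := S) (β := β) (field h)).ennreal_toReal, ?_⟩
    filter_upwards [hae] with ω hω
    rw [hω, ENNReal.toReal_ofReal (hnn ω)]
  have hlint := (lintegral_congr_ae hae).symm.trans
    (lintegral_trace_evolution (field h) hu hβ.le)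
  have hZ : 0 ≤ Real.exp (-(β * G.edgeFinset.card)) *
      (NormedSpace.exp (β • (Matrix.diagonal (field h) + hopping G S u) :
        Matrix (Config V S) (Config V S) ℝ)).trace :=
    mul_nonneg (Real.exp_nonneg _) (Finset.sum_nonneg fun σ _ =>
      (hasSum_dyson (hopping_nonneg G hu) hβ.le σ σ).nonneg fun n =>
        dyson_nonneg (hopping_nonneg G hu) n hβ.le σ σ)
  refine ⟨⟨hmeas, ?_⟩, ?_⟩
  · rw [hasFiniteIntegral_iff_ofReal (Filter.Eventually.of_forall hnn), hlint]
    exact ENNReal.ofReal_lt_top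
  · rw [partitionFunction_eq, integral_eq_lintegral_of_nonneg_ae (Filter.Eventually.of_forall hnn)
      hmeas, hlint, ENNReal.toReal_ofReal hZ]

end Poisson

end

end RandomLoop

theorem theorem4p3 {V : Type*} [Fintype V] [DecidableEq V] (G : SimpleGraph V)
    [DecidableRel G.Adj] (S : ℕ) (u : ℝ) (hu : u ∈ Set.Icc (0 : ℝ) 1) (β : ℝ) (hβ : 0 < β)
    (h : V → ℝ)
    (o : ∀ ω : RandomLoop.Realization G, RandomLoop.Loop β ω → RandomLoop.OrientedLoop β ω)
    (ho : ∀ (ω : RandomLoop.Realization G) (γ : RandomLoop.Loop β ω), (o ω γ).forget = γ) :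
    Integrable
      (fun ω : RandomLoop.Realization G =>
        ∏ᶠ γ : RandomLoop.Loop β ω, RandomLoop.weight S h (o ω γ))
      (RandomLoop.rho G u β) ∧
    RandomLoop.partitionFunction G S u β h =
      ((∫ ω : RandomLoop.Realization G,
        ∏ᶠ γ : RandomLoop.Loop β ω, RandomLoop.weight S h (o ω γ)
          ∂(RandomLoop.rho G u β) : ℝ) : ℂ) :=
  RandomLoop.integrable_and_partitionFunction_eq S hu hβ h o ho
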